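/- **Setting.** *Syntax.* Fix infinite sets of regular variables $x$, confined variables $i$ (also called level variables) and constants $c$. Sorts are $s ::= \mathsf{Type}\mid\mathsf{Kind}$; levels are $l ::= i \mid 0 \mid \mathsf S\,l \mid l\sqcup l'$; terms and types are $$A,B,t,u ::= x\mid c\mid s\mid (x:A)\to B\mid x.t\mid t\,u\mid (i:A)\to B\mid i.t\mid t\,l .$$ A context $\Gamma$ is a sequence of entries $x:A$ or $i:A$. A local signature $\Phi$ is a finite sequence of entries $c:A$ or $c:A:=t$ with distinct names. *The theory $\mathbb{UPP}$.* It has the constant $\mathsf{Lvl}:\mathsf{Type}$, the confined constants $0:()\to\mathsf{Lvl}$, $\mathsf S:(i:\mathsf{Lvl})\to\mathsf{Lvl}$ and $\sqcup:(i,i':\mathsf{Lvl})\to\mathsf{Lvl}$, and the constants - $\mathsf{Ty}:(l:\mathsf{Lvl})\to\mathsf{Type}$, $\ \mathsf{Tm}:(l:\mathsf{Lvl})\to\mathsf{Ty}\,l\to\mathsf{Type}$, $\ \mathsf U:(l:\mathsf{Lvl})\to\mathsf{Ty}\,(\mathsf S\,l)$, - $\Pi:(l\,l':\mathsf{Lvl})\to(A:\mathsf{Ty}\,l)\to(B:\mathsf{Tm}\,l\,A\to\mathsf{Ty}\,l')\to\mathsf{Ty}\,(l\sqcup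 l')$, - $\lambda:(l\,l':\mathsf{Lvl})\to(A:\mathsf{Ty}\,l)\to(B:\mathsf{Tm}\,l\,A\to\mathsf{Ty}\,l')\to((x:\mathsf{Tm}\,l\,A)\to\mathsf{Tm}\,l'\,(B\,x))\to\mathsf{Tm}\,(l\sqcup l')\,(\Pi\,l\,l'\,A\,B)$, - $@:(l\,l':\mathsf{Lvl})\to(A:\mathsf{Ty}\,l)\to(B:\mathsf{Tm}\,l\,A\to\mathsf{Ty}\,l')\to(t:\mathsf{Tm}\,(l\sqcup l')\,(\Pi\,l\,l'\,A\,B))\to(u:\mathsf{Tm}\,l\,A)\to\mathsf{Tm}\,l'\,(B\,u)$. Its rewrite rules are $\mathsf{Tm}\,l'\,(\mathsf U\,l)\longrightarrow\mathsf{Ty}\,l$ and $@\,l\,l'\,A\,B\,(\lambda\,l''\,l'''\,A'\,B'\,t)\,u\longrightarrow t\,u$. The relation $\simeq$ is the congruence generated by the equations on levels $$i_1\sqcup(i_2\sqcup i_3)\simeq(i_1\sqcup i_2)\sqcup i_3,\quad i_1\sqcup i_2\simeq i_2\sqcup i_1,\quad \mathsf S(i_1\sqcup i_2)\simeq\mathsf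 S\,i_1\sqcup\mathsf S\,i_2,$$ $$i\sqcup\mathsf S\,i\simeq\mathsf S\,i,\quad i\sqcup 0\simeq i,\quad i\sqcup i\simeq i .$$ Given a local signature, $\longrightarrow$ is the closure by context of these rewrite rules, of $(x.t)u\longrightarrow t[x\mapsto u]$, of $(i.t)l\longrightarrow t[i\mapsto l]$ and of the unfolding $c\longrightarrow t$ of each definition $c:A:=t$; $\equiv$ is the equivalence relation generated by $\longrightarrow$ and $\simeq$. *Typing.* $\Gamma\vdash$, $\Gamma\vdash t:A$ and $\Gamma\vdash l:A$ are the least relations satisfying the following (for $\mathbb{UPP}$ extended with the local signature). The empty context is well-formed, and $\Gamma,x:A$ and $\Gamma,i:A$ are if $\Gamma\vdash A:\mathsf{Type}$. If $\Gamma\vdash$, then $\Gamma\vdash\mathsf{Type}:\mathsf{Kind}$, every variable and every constant has its declared type, and $\Gamma\vdash0:\mathsf{Lvl}$; $\mathsf S$ and $\sqcup$ applied to levels of type $\mathsf{Lvl}$ have type $\mathsf{Lvl}$. If $\Gamma\vdash t:A$, $\Gamma\vdash B:s$ and $A\equiv B$, then $\Gamma\vdash t:B$ (likewise for a level $l$,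 with $s=\mathsf{Type}$). If $\Gamma\vdash A:\mathsf{Type}$ and $\Gamma,x:A\vdash B:s$, then $\Gamma\vdash(x:A)\to B:s$, and if also $\Gamma,x:A\vdash t:B$, then $\Gamma\vdash x.t:(x:A)\to B$. If $\Gamma\vdash t:(x:A)\to B$ and $\Gamma\vdash u:A$, then $\Gamma\vdash t\,u:B[x\mapsto u]$. The last two clauses hold in the same way with a confined variable $i$ instead of $x$, and a level $l:A$ instead of $u$. A local signature is *well-formed in $\mathbb{UPP}$* if each entry is valid in $\mathbb{UPP}$ extended with the preceding entries: $c:A$ is valid if $()\vdash A:s$ for some sort $s$, and $c:A:=t$ is valid if $()\vdash t:A$. *Schematic terms* are the terms without confined abstractions $i.t$ and confined function types $(i:A)\to B$ in which the only levels are level variables, occurring as arguments of constant applications $c\,i_1\dots i_k$. *Constraints.* A problem $\mathcal C$ is a set of equations $l\doteq l'$ between levels. A substitution $\theta$ of levels for level variables is a *unifier* of $\mathcal C$ if $l[\theta]\simeq l'[\theta]$ for all $l\doteq l'$ in $\mathcal C$. *The elaborator*, over a local signature $\Phi'$. Write $t\longrightarrow^{\mathrm{wh}}u$ if $t\longrightarrow^*u$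 and, whenever $u\longrightarrow^*u'\,a_1\dots a_k$ with $k\ge0$ and each $a_j$ a term or a level, $u'$ matches no left-hand side of a rewrite rule (including the two $\beta$-rules and the unfolding of definitions). The following judgments are inductively defined. - $A\equiv B\downarrow\mathcal C$ if $A\longrightarrow^{\mathrm{wh}}A'$, $B\longrightarrow^{\mathrm{wh}}B'$ and $A'\equiv_{\mathrm{whnf}}B'\downarrow\mathcal C$. - $t\equiv_{\mathrm{whnf}}t\downarrow\emptyset$ for $t$ a variable, constant or sort; $x.t\equiv_{\mathrm{whnf}}x.t'\downarrow\mathcal C$ if $t\equiv t'\downarrow\mathcal C$; $(x:A)\to B\equiv_{\mathrm{whnf}}(x:A')\to B'\downarrow\mathcal C_1\cup\mathcal C_2$ if $A\equiv A'\downarrow\mathcal C_1$ and $B\equiv B'\downarrow\mathcal C_2$; $t\,u\equiv_{\mathrm{whnf}}t'\,u'\downarrow\mathcal C_1\cup\mathcal C_2$ if $t\equiv_{\mathrm{whnf}}t'\downarrow\mathcal C_1$ and $u\equiv u'\downarrow\mathcal C_2$; $t\,l\equiv_{\mathrm{whnf}}t'\,l'\downarrow\mathcal C\cup\{l\doteq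 l'\}$ if $t\equiv_{\mathrm{whnf}}t'\downarrow\mathcal C$. - Checking: $\Gamma\uparrow\mathcal D\vdash t\Leftarrow B\downarrow\mathcal C_1\cup\mathcal C_2$ if $\Gamma\uparrow\mathcal D\vdash t\Rightarrow A\downarrow\mathcal C_1$ and $A\equiv B\downarrow\mathcal C_2$; $\ \Gamma\uparrow\mathcal D\vdash x.t\Leftarrow T\downarrow\mathcal C$ if $T\longrightarrow^{\mathrm{wh}}(x:A)\to B$ and $\Gamma,x:A\uparrow\mathcal D\vdash t\Leftarrow B\downarrow\mathcal C$. - Inference: $\Gamma\uparrow\mathcal D\vdash x\Rightarrow A\downarrow\emptyset$ if $x:A\in\Gamma$; $\ \Gamma\uparrow\mathcal D\vdash c\,i_1\dots i_k\Rightarrow B[\vec j\mapsto\vec i]\downarrow\emptyset$ if $c$ has type $(j_1\dots j_k:\mathsf{Lvl})\to B$ in $\mathbb{UPP}$ or $\Phi'$; $\ \Gamma\uparrow\mathcal D\vdash\mathsf{Type}\Rightarrow\mathsf{Kind}\downarrow\emptyset$; $\ \Gamma\uparrow\mathcal D\vdash(x:A)\to B\Rightarrow s\downarrow\mathcal C_1\cup\mathcal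 C_2$ if $\Gamma\uparrow\mathcal D\vdash A\Leftarrow\mathsf{Type}\downarrow\mathcal C_1$, $\Gamma,x:A\uparrow\mathcal D\cup\mathcal C_1\vdash B\Rightarrow T\downarrow\mathcal C_2$ and $T\longrightarrow^{\mathrm{wh}}s$; $\ \Gamma\uparrow\mathcal D\vdash t\,u\Rightarrow B[x\mapsto u]\downarrow\mathcal C_1\cup\mathcal C_2$ if $\Gamma\uparrow\mathcal D\vdash t\Rightarrow T\downarrow\mathcal C_1$, $T\longrightarrow^{\mathrm{wh}}(x:A)\to B$ and $\Gamma\uparrow\mathcal D\cup\mathcal C_1\vdash u\Leftarrow A\downarrow\mathcal C_2$. **Theorem (Correctness of elaboration).** Let $\Phi'$ be a local signature well-formed in $\mathbb{UPP}$, let $A,t$ be schematic terms, and let $c$ be a name that neither $\mathbb{UPP}$ nor $\Phi'$ declares. For a level substitution $\theta$, let $\vec i_{A[\theta]}$ be the level variables occurring free in $A[\theta]$, listed without repetition in any order, and let $\vec i_{t[\theta]\setminus A[\theta]}$ be those occurring free in $t[\theta]$ but not in $A[\theta]$. 1. Suppose $()\uparrow\emptyset\vdash A\Leftarrow\mathsf{Type}\downarrow\mathcal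 C_1$ and $()\uparrow\mathcal C_1\vdash t\Leftarrow A\downarrow\mathcal C_2$, and let $\theta$ be any unifier of $\mathcal C_1\cup\mathcal C_2$ (for instance the one that a unification procedure $\textsc{Unify}$ returns on $\mathcal C_1\cup\mathcal C_2$). Then $$\Phi',\ c:(\vec i_{A[\theta]}:\mathsf{Lvl})\to A[\theta]\ :=\ \vec i_{A[\theta]}.\ t[\theta][\vec i_{t[\theta]\setminus A[\theta]}\mapsto0]$$ is well-formed in $\mathbb{UPP}$. 2. Suppose $()\uparrow\emptyset\vdash A\Leftarrow\mathsf{Type}\downarrow\mathcal C_1$, and let $\theta$ be any unifier of $\mathcal C_1$. Then $\Phi',\ c:(\vec i_{A[\theta]}:\mathsf{Lvl})\to A[\theta]$ is well-formed in $\mathbb{UPP}$. -/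

import Mathlib

namespace UPP

/-!
The logical framework (Dedukti with confinement) instantiated with the theory UPP, extended by an
arbitrary local signature; then the constraint-computing elaborator.

Binding is represented by de Bruijn indices, with two independent index spaces: one for regular
variables (bound by `pi`, `lam`) and one for confined variables (bound by `cpi`, `clam`).
A confined variable that no binder captures is a free level variable; there are infinitely many.
-/

/-! ### Raw expressions -/

/-- Confined terms of UPP, i.e. universe levels: variables, `0`, `S l`, `l ⊔ l'`. -/
inductive Level : Type
  | var (i : ℕ)
  | zero
  | succ (l : Level)
  | max (l l' : Level)

/-- The two sorts of the framework. -/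
inductive DkSort : Type
  | type
  | kind

/-- Non-confined constants: the seven constants of the global signature of UPP, and the names
available for local signatures. -/
inductive Const : Type
  | lvl | ty | tm | univ | prod | abs | app
  | user (name : ℕ)

/-- Raw terms and types. -/
inductive Term : Type
  /-- a regular variable -/
  | var (x : ℕ)
  /-- a constant -/
  | const (c : Const)
  /-- `Type` or `Kind` -/
  | sort (s : DkSort)
  /-- `(x : A) → B` -/
  | pi (A B : Term)
  /-- `x. t` -/
  | lam (t : Term)
  /-- `t u` -/
  | app (t u : Term)
  /-- `(i : A) → B` with `i` confined -/
  | cpi (A B : Term)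
  /-- `i. t` with `i` confined -/
  | clam (t : Term)
  /-- `t l` with `l` confined -/
  | capp (t : Term) (l : Level)

/-! ### Renaming and substitution -/

/-- A level substitution; it is the identity (`Level.var`) outside its domain. -/
abbrev LevelSubst : Type := ℕ → Level

/-- `l[θ]`. -/
def Level.subst (θ : LevelSubst) : Level → Level
  | .var i => θ i
  | .zero => .zero
  | .succ l => .succ (l.subst θ)
  | .max l l' => .max (l.subst θ) (l'.subst θ)

/-- Free variables of a level. -/
def Level.fv : Level → Finset ℕ
  | .var i => {i}
  | .zero => ∅
  | .succ l => l.fv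
  | .max l l' => l.fv ∪ l'.fv

/-- Renaming of the variables of a level. -/
def Level.rename (ξ : ℕ → ℕ) (l : Level) : Level := l.subst fun i => .var (ξ i)

/-- Extension of a renaming below a binder of the same kind. -/
def upRen (ρ : ℕ → ℕ) : ℕ → ℕ
  | 0 => 0
  | n + 1 => ρ n + 1

/-- Simultaneous renaming of regular variables (by `ρ`) and confined variables (by `ξ`). -/
def Term.rename (ρ ξ : ℕ → ℕ) : Term → Term
  | .var x => .var (ρ x)
  | .const c => .const c
  | .sort s => .sort s
  | .pi A B => .pi (A.rename ρ ξ) (B.rename (upRen ρ) ξ)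
  | .lam t => .lam (t.rename (upRen ρ) ξ)
  | .app t u => .app (t.rename ρ ξ) (u.rename ρ ξ)
  | .cpi A B => .cpi (A.rename ρ ξ) (B.rename ρ (upRen ξ))
  | .clam t => .clam (t.rename ρ (upRen ξ))
  | .capp t l => .capp (t.rename ρ ξ) (l.rename ξ)

/-- Weakening by one regular variable. -/
def Term.shift (t : Term) : Term := t.rename Nat.succ id

/-- Weakening by one confined variable. -/
def Term.cshift (t : Term) : Term := t.rename id Nat.succ

/-- Extension of a level substitution below a confined binder. -/
def LevelSubst.up (θ : LevelSubst) : LevelSubst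
  | 0 => .var 0
  | n + 1 => (θ n).rename Nat.succ

/-- Extension of a substitution for regular variables below a regular binder. -/
def upSubst (σ : ℕ → Term) : ℕ → Term
  | 0 => .var 0
  | n + 1 => (σ n).shift

/-- Simultaneous capture-avoiding substitution of terms for regular variables and of levels for
confined variables. -/
def Term.subst (σ : ℕ → Term) (θ : LevelSubst) : Term → Term
  | .var x => σ x
  | .const c => .const c
  | .sort s => .sort s
  | .pi A B => .pi (A.subst σ θ) (B.subst (upSubst σ) θ)
  | .lam t => .lam (t.subst (upSubst σ) θ)
  | .app t u => .app (t.subst σ θ) (u.subst σ θ)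
  | .cpi A B => .cpi (A.subst σ θ) (B.subst (fun x => (σ x).cshift) θ.up)
  | .clam t => .clam (t.subst (fun x => (σ x).cshift) θ.up)
  | .capp t l => .capp (t.subst σ θ) (l.subst θ)

/-- `t[θ]` for a level substitution `θ`. -/
def Term.lsubst (θ : LevelSubst) (t : Term) : Term := t.subst .var θ

/-- `B[x ↦ u]`, where `x` is the regular variable with index `0`. -/
def Term.inst (B u : Term) : Term :=
  B.subst (fun n => match n with | 0 => u | k + 1 => .var k) .var

/-- `B[i ↦ l]`, where `i` is the confined variable with index `0`. -/
def Term.cinst (B : Term) (l : Level) : Term :=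
  B.lsubst (fun n => match n with | 0 => l | k + 1 => .var k)

/-- The free level variables of a term. -/
def Term.lfv : Term → Finset ℕ
  | .var _ => ∅
  | .const _ => ∅
  | .sort _ => ∅
  | .pi A B => A.lfv ∪ B.lfv
  | .lam t => t.lfv
  | .app t u => t.lfv ∪ u.lfv
  | .cpi A B => A.lfv ∪ (B.lfv.erase 0).image Nat.pred
  | .clam t => (t.lfv.erase 0).image Nat.pred
  | .capp t l => t.lfv ∪ l.fv

/-! ### The signature of UPP and local signatures -/

abbrev Lvl : Term := .const .lvl
abbrev Ty (l : Level) : Term := .capp (.const .ty) l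
abbrev Tm (l : Level) (A : Term) : Term := .app (.capp (.const .tm) l) A
abbrev U (l : Level) : Term := .capp (.const .univ) l
abbrev Prod (l l' : Level) (A B : Term) : Term :=
  .app (.app (.capp (.capp (.const .prod) l) l') A) B
abbrev Abs (l l' : Level) (A B t : Term) : Term :=
  .app (.app (.app (.capp (.capp (.const .abs) l) l') A) B) t
abbrev App (l l' : Level) (A B t u : Term) : Term :=
  .app (.app (.app (.app (.capp (.capp (.const .app) l) l') A) B) t) u

/-- An entry `c : A` (`body = none`) or `c : A := t` (`body = some t`) of a local signature. -/
structure Entry : Type where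
  name : ℕ
  type : Term
  body : Option Term

/-- A local signature, the most recent entry first: `Φ, e` is `e :: Φ`. -/
abbrev LocalSig : Type := List Entry

/-- `HasConst Φ c A`: the constant `c` is declared or defined with type `A` in the global signature
of UPP or in the local signature `Φ`.

In the global types, `(l l' : Lvl)` are the confined variables `1` and `0`. -/
inductive HasConst (Φ : LocalSig) : Const → Term → Prop
  /-- `Lvl : Type` -/
  | lvl : HasConst Φ .lvl (.sort .type)
  /-- `Ty : (l : Lvl) → Type` -/
  | ty : HasConst Φ .ty (.cpi Lvl (.sort .type))
  /-- `Tm : (l : Lvl) → Ty l → Type` -/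
  | tm : HasConst Φ .tm (.cpi Lvl (.pi (Ty (.var 0)) (.sort .type)))
  /-- `U : (l : Lvl) → Ty (S l)` -/
  | univ : HasConst Φ .univ (.cpi Lvl (Ty (.succ (.var 0))))
  /-- `Π : (l l' : Lvl) → (A : Ty l) → (B : Tm l A → Ty l') → Ty (l ⊔ l')` -/
  | prod : HasConst Φ .prod
      (.cpi Lvl (.cpi Lvl
        (.pi (Ty (.var 1))
        (.pi (.pi (Tm (.var 1) (.var 0)) (Ty (.var 0)))
          (Ty (.max (.var 1) (.var 0)))))))
  /-- `λ : (l l' : Lvl) → (A : Ty l) → (B : Tm l A → Ty l') → ((x : Tm l A) → Tm l' (B x)) →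
  Tm (l ⊔ l') (Π l l' A B)` -/
  | abs : HasConst Φ .abs
      (.cpi Lvl (.cpi Lvl
        (.pi (Ty (.var 1))
        (.pi (.pi (Tm (.var 1) (.var 0)) (Ty (.var 0)))
        (.pi (.pi (Tm (.var 1) (.var 1)) (Tm (.var 0) (.app (.var 1) (.var 0))))
          (Tm (.max (.var 1) (.var 0)) (Prod (.var 1) (.var 0) (.var 2) (.var 1))))))))
  /-- `@ : (l l' : Lvl) → (A : Ty l) → (B : Tm l A → Ty l') → (t : Tm (l ⊔ l') (Π l l' A B)) →
  (u : Tm l A) → Tm l' (B u)` -/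
  | app : HasConst Φ .app
      (.cpi Lvl (.cpi Lvl
        (.pi (Ty (.var 1))
        (.pi (.pi (Tm (.var 1) (.var 0)) (Ty (.var 0)))
        (.pi (Tm (.max (.var 1) (.var 0)) (Prod (.var 1) (.var 0) (.var 1) (.var 0)))
        (.pi (Tm (.var 1) (.var 2))
          (Tm (.var 0) (.app (.var 2) (.var 0)))))))))
  /-- constants of the local signature -/
  | user {e : Entry} : e ∈ Φ → HasConst Φ (.user e.name) e.type

/-! ### Conversion -/

/-- The equational theory of levels: the congruence generated by (all instances of) the six
equations of UPP. -/
inductive LevelEq : Level → Level → Prop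
  | refl (l) : LevelEq l l
  | symm {l l'} : LevelEq l l' → LevelEq l' l
  | trans {l l' l''} : LevelEq l l' → LevelEq l' l'' → LevelEq l l''
  | succ {l l'} : LevelEq l l' → LevelEq (.succ l) (.succ l')
  | max {l₁ l₁' l₂ l₂'} : LevelEq l₁ l₁' → LevelEq l₂ l₂' → LevelEq (.max l₁ l₂) (.max l₁' l₂')
  | max_assoc (l₁ l₂ l₃) : LevelEq (.max l₁ (.max l₂ l₃)) (.max (.max l₁ l₂) l₃)
  | max_comm (l₁ l₂) : LevelEq (.max l₁ l₂) (.max l₂ l₁)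
  | succ_max (l₁ l₂) : LevelEq (.succ (.max l₁ l₂)) (.max (.succ l₁) (.succ l₂))
  | max_succ_self (l) : LevelEq (.max l (.succ l)) (.succ l)
  | max_zero (l) : LevelEq (.max l .zero) l
  | max_self (l) : LevelEq (.max l l) l

/-- The relation `≃` on terms: same shape, with equivalent levels at corresponding places
(that is, the closure by context of `LevelEq`, which is an equivalence relation). -/
inductive TermEq : Term → Term → Prop
  | var (x) : TermEq (.var x) (.var x)
  | const (c) : TermEq (.const c) (.const c)
  | sort (s) : TermEq (.sort s) (.sort s)
  | pi {A A' B B'} : TermEq A A' → TermEq B B' → TermEq (.pi A B) (.pi A' B')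
  | lam {t t'} : TermEq t t' → TermEq (.lam t) (.lam t')
  | app {t t' u u'} : TermEq t t' → TermEq u u' → TermEq (.app t u) (.app t' u')
  | cpi {A A' B B'} : TermEq A A' → TermEq B B' → TermEq (.cpi A B) (.cpi A' B')
  | clam {t t'} : TermEq t t' → TermEq (.clam t) (.clam t')
  | capp {t t' l l'} : TermEq t t' → LevelEq l l' → TermEq (.capp t l) (.capp t' l')

/-- Instances of the rewrite rules: `β`, `β` for confined abstractions, the two rules of UPP, and
the unfolding `δ` of the definitions of `Φ`. -/
inductive RootStep (Φ : LocalSig) : Term → Term → Prop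
  | beta (t u) : RootStep Φ (.app (.lam t) u) (t.inst u)
  | cbeta (t l) : RootStep Φ (.capp (.clam t) l) (t.cinst l)
  | tm_univ (l' l) : RootStep Φ (Tm l' (U l)) (Ty l)
  | app_abs (l l' A B l'' l''' A' B' t u) :
      RootStep Φ (App l l' A B (Abs l'' l''' A' B' t) u) (.app t u)
  | delta {c A t} : (⟨c, A, some t⟩ : Entry) ∈ Φ → RootStep Φ (.const (.user c)) t

/-- One-step reduction `⟶`: the closure by context of `RootStep`. -/
inductive Step (Φ : LocalSig) : Term → Term → Prop
  | root {t t'} : RootStep Φ t t' → Step Φ t t'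
  | pi_left {A A' B} : Step Φ A A' → Step Φ (.pi A B) (.pi A' B)
  | pi_right {A B B'} : Step Φ B B' → Step Φ (.pi A B) (.pi A B')
  | lam {t t'} : Step Φ t t' → Step Φ (.lam t) (.lam t')
  | app_left {t t' u} : Step Φ t t' → Step Φ (.app t u) (.app t' u)
  | app_right {t u u'} : Step Φ u u' → Step Φ (.app t u) (.app t u')
  | cpi_left {A A' B} : Step Φ A A' → Step Φ (.cpi A B) (.cpi A' B)
  | cpi_right {A B B'} : Step Φ B B' → Step Φ (.cpi A B) (.cpi A B')
  | clam {t t'} : Step Φ t t' → Step Φ (.clam t) (.clam t')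
  | capp {t t' l} : Step Φ t t' → Step Φ (.capp t l) (.capp t' l)

/-- Many-step reduction. -/
def Steps (Φ : LocalSig) : Term → Term → Prop := Relation.ReflTransGen (Step Φ)

/-- Conversion `≡`: the equivalence relation generated by `⟶` and `≃`. -/
def Conv (Φ : LocalSig) : Term → Term → Prop :=
  Relation.EqvGen fun t u => Step Φ t u ∨ TermEq t u

/-! ### Typing -/

/-- Context entries `x : A` (`reg A`) and `i : A` (`conf A`). -/
inductive CtxEntry : Type
  | reg (A : Term)
  | conf (A : Term)

/-- Contexts, the most recent entry first: `Γ, x : A` is `.reg A :: Γ`. -/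
abbrev Ctx : Type := List CtxEntry

/-- `x : A ∈ Γ` for a regular variable (types are weakened to the whole of `Γ`). -/
inductive Lookup : Ctx → ℕ → Term → Prop
  | here {Γ A} : Lookup (.reg A :: Γ) 0 A.shift
  | reg {Γ x A B} : Lookup Γ x A → Lookup (.reg B :: Γ) (x + 1) A.shift
  | conf {Γ x A B} : Lookup Γ x A → Lookup (.conf B :: Γ) x A.cshift

/-- `i : A ∈ Γ` for a confined variable. -/
inductive CLookup : Ctx → ℕ → Term → Prop
  | here {Γ A} : CLookup (.conf A :: Γ) 0 A.cshift
  | conf {Γ i A B} : CLookup Γ i A → CLookup (.conf B :: Γ) (i + 1) A.cshift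
  | reg {Γ i A B} : CLookup Γ i A → CLookup (.reg B :: Γ) i A.shift

mutual

/-- `Γ ⊢` in UPP extended with `Φ`. -/
inductive WfCtx (Φ : LocalSig) : Ctx → Prop
  | nil : WfCtx Φ []
  | reg {Γ A} : HasType Φ Γ A (.sort .type) → WfCtx Φ (.reg A :: Γ)
  | conf {Γ A} : HasType Φ Γ A (.sort .type) → WfCtx Φ (.conf A :: Γ)

/-- `Γ ⊢ t : A` in UPP extended with `Φ`. -/
inductive HasType (Φ : LocalSig) : Ctx → Term → Term → Prop
  | sort {Γ} : WfCtx Φ Γ → HasType Φ Γ (.sort .type) (.sort .kind)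
  | var {Γ x A} : WfCtx Φ Γ → Lookup Γ x A → HasType Φ Γ (.var x) A
  | const {Γ c A} : WfCtx Φ Γ → HasConst Φ c A → HasType Φ Γ (.const c) A
  | conv {Γ t A B s} : HasType Φ Γ t A → HasType Φ Γ B (.sort s) → Conv Φ A B → HasType Φ Γ t B
  | pi {Γ A B s} : HasType Φ Γ A (.sort .type) → HasType Φ (.reg A :: Γ) B (.sort s) →
      HasType Φ Γ (.pi A B) (.sort s)
  | cpi {Γ A B s} : HasType Φ Γ A (.sort .type) → HasType Φ (.conf A :: Γ) B (.sort s) →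
      HasType Φ Γ (.cpi A B) (.sort s)
  | lam {Γ A B t s} : HasType Φ Γ A (.sort .type) → HasType Φ (.reg A :: Γ) B (.sort s) →
      HasType Φ (.reg A :: Γ) t B → HasType Φ Γ (.lam t) (.pi A B)
  | clam {Γ A B t s} : HasType Φ Γ A (.sort .type) → HasType Φ (.conf A :: Γ) B (.sort s) →
      HasType Φ (.conf A :: Γ) t B → HasType Φ Γ (.clam t) (.cpi A B)
  | app {Γ A B t u} : HasType Φ Γ t (.pi A B) → HasType Φ Γ u A → HasType Φ Γ (.app t u) (B.inst u)
  | capp {Γ A B t l} : HasType Φ Γ t (.cpi A B) → HasCType Φ Γ l A →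
      HasType Φ Γ (.capp t l) (B.cinst l)

/-- `Γ ⊢ l : A` for confined terms `l`, in UPP extended with `Φ`; the confined constants are
`0 : () → Lvl`, `S : (i : Lvl) → Lvl` and `⊔ : (i : Lvl, i' : Lvl) → Lvl`. -/
inductive HasCType (Φ : LocalSig) : Ctx → Level → Term → Prop
  | var {Γ i A} : WfCtx Φ Γ → CLookup Γ i A → HasCType Φ Γ (.var i) A
  | zero {Γ} : WfCtx Φ Γ → HasCType Φ Γ .zero Lvl
  | succ {Γ l} : HasCType Φ Γ l Lvl → HasCType Φ Γ (.succ l) Lvl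
  | max {Γ l l'} : HasCType Φ Γ l Lvl → HasCType Φ Γ l' Lvl → HasCType Φ Γ (.max l l') Lvl
  | conv {Γ l A B} : HasCType Φ Γ l A → HasType Φ Γ B (.sort .type) → Conv Φ A B →
      HasCType Φ Γ l B

end

/-- The name `c` is not used by any entry of `Φ`. -/
def Fresh (c : ℕ) (Φ : LocalSig) : Prop := ∀ e ∈ Φ, e.name ≠ c

/-- The local signature is well-formed in UPP: names are distinct and each entry is valid in UPP
extended with the entries that precede it. -/
inductive WfSig : LocalSig → Prop
  | nil : WfSig []
  | decl {Φ c A s} : WfSig Φ → Fresh c Φ → HasType Φ [] A (.sort s) →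
      WfSig (⟨c, A, none⟩ :: Φ)
  | defn {Φ c A t} : WfSig Φ → Fresh c Φ → HasType Φ [] t A →
      WfSig (⟨c, A, some t⟩ :: Φ)

/-! ### Schematic terms -/

/-- `c i₁ … iₖ` for level variables `i₁, …, iₖ`. -/
def constApp (c : Const) (is : List ℕ) : Term :=
  is.foldl (fun t i => .capp t (.var i)) (.const c)

/-- Schematic terms: no confined binders, and the only levels are level variables appearing as
arguments of constant applications. -/
inductive Schematic : Term → Prop
  | var (x) : Schematic (.var x)
  | const (c is) : Schematic (constApp c is)
  | sort (s) : Schematic (.sort s)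
  | pi {A B} : Schematic A → Schematic B → Schematic (.pi A B)
  | lam {t} : Schematic t → Schematic (.lam t)
  | app {t u} : Schematic t → Schematic u → Schematic (.app t u)

/-! ### Level constraints -/

/-- A level unification problem: a set of equations between levels. -/
abbrev Problem : Type := Set (Level × Level)

/-- `θ ⊨ C`: the level substitution `θ` is a unifier of the problem `C`. -/
def Unifies (θ : LevelSubst) (C : Problem) : Prop :=
  ∀ p ∈ C, LevelEq (p.1.subst θ) (p.2.subst θ)

/-! ### The elaborator -/

/-- `t a₁ … aₖ`, each `aᵢ` being a regular or confined term. -/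
def Term.apps (t : Term) (as : List (Term ⊕ Level)) : Term :=
  as.foldl (fun t a => match a with | .inl u => .app t u | .inr l => .capp t l) t

/-- Weak-head normal forms: whenever `u` reduces to `u' a₁ … aₖ`, the head `u'` matches no
left-hand side of a rewrite rule. -/
def Whnf (Φ : LocalSig) (u : Term) : Prop :=
  ∀ (u' : Term) (as : List (Term ⊕ Level)), Steps Φ u (u'.apps as) → ∀ v, ¬ RootStep Φ u' v

/-- Reduction to a weak-head normal form. -/
def WhSteps (Φ : LocalSig) (t u : Term) : Prop := Steps Φ t u ∧ Whnf Φ u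

mutual

/-- `A ≡ B ↓ C`. -/
inductive ConvGen (Φ : LocalSig) : Term → Term → Problem → Prop
  | mk {A B A' B' C} : WhSteps Φ A A' → WhSteps Φ B B' → ConvWhnf Φ A' B' C → ConvGen Φ A B C

/-- `A ≡ B ↓ C` for terms in weak-head normal form. -/
inductive ConvWhnf (Φ : LocalSig) : Term → Term → Problem → Prop
  | var (x) : ConvWhnf Φ (.var x) (.var x) ∅
  | const (c) : ConvWhnf Φ (.const c) (.const c) ∅
  | sort (s) : ConvWhnf Φ (.sort s) (.sort s) ∅
  | lam {t t' C} : ConvGen Φ t t' C → ConvWhnf Φ (.lam t) (.lam t') C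
  | pi {A A' B B' C₁ C₂} : ConvGen Φ A A' C₁ → ConvGen Φ B B' C₂ →
      ConvWhnf Φ (.pi A B) (.pi A' B') (C₁ ∪ C₂)
  | app {t t' u u' C₁ C₂} : ConvWhnf Φ t t' C₁ → ConvGen Φ u u' C₂ →
      ConvWhnf Φ (.app t u) (.app t' u') (C₁ ∪ C₂)
  | capp {t t' l l' C} : ConvWhnf Φ t t' C → ConvWhnf Φ (.capp t l) (.capp t' l') (C ∪ {(l, l')})

end

/-- `(j₁ … jₖ : Lvl) → B`. -/
def lvlPis : ℕ → Term → Term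
  | 0, B => B
  | k + 1, B => .cpi Lvl (lvlPis k B)

/-- The substitution `[j₁ … jₖ ↦ i₁ … iₖ]` for the body `B` of `(j₁ … jₖ : Lvl) → B`; the last
variable `jₖ` has index `0`, and the substitution removes the `k` bound indices. -/
def instLevels (is : List ℕ) : LevelSubst := fun n =>
  match is.reverse[n]? with
  | some i => .var i
  | none => .var (n - is.length)

mutual

/-- `Γ ↑ D ⊢ t ⇐ A ↓ C`. -/
inductive Check (Φ : LocalSig) : Ctx → Problem → Term → Term → Problem → Prop
  | switch {Γ D t A B C₁ C₂} : Infer Φ Γ D t A C₁ → ConvGen Φ A B C₂ →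
      Check Φ Γ D t B (C₁ ∪ C₂)
  | lam {Γ D t A B T C} : WhSteps Φ T (.pi A B) → Check Φ (.reg A :: Γ) D t B C →
      Check Φ Γ D (.lam t) T C

/-- `Γ ↑ D ⊢ t ⇒ A ↓ C`. -/
inductive Infer (Φ : LocalSig) : Ctx → Problem → Term → Term → Problem → Prop
  | var {Γ D x A} : Lookup Γ x A → Infer Φ Γ D (.var x) A ∅
  | const {Γ D c B} {is : List ℕ} : HasConst Φ c (lvlPis is.length B) →
      Infer Φ Γ D (constApp c is) (B.lsubst (instLevels is)) ∅
  | sort {Γ D} : Infer Φ Γ D (.sort .type) (.sort .kind) ∅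
  | pi {Γ D A B T s C₁ C₂} : Check Φ Γ D A (.sort .type) C₁ →
      Infer Φ (.reg A :: Γ) (D ∪ C₁) B T C₂ → WhSteps Φ T (.sort s) →
      Infer Φ Γ D (.pi A B) (.sort s) (C₁ ∪ C₂)
  | app {Γ D t u A B T C₁ C₂} : Infer Φ Γ D t T C₁ → WhSteps Φ T (.pi A B) →
      Check Φ Γ (D ∪ C₁) u A C₂ → Infer Φ Γ D (.app t u) (B.inst u) (C₁ ∪ C₂)

end

/-! ### Generalization over level variables -/

/-- The renaming that turns the free variable `i` into the variable bound by a new confined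
binder. -/
def captureRen (i : ℕ) : ℕ → ℕ := fun n => if n = i then 0 else n + 1

/-- `(i₁ … iₖ : Lvl) → A`, binding the free level variables `i₁, …, iₖ` of `A`. -/
def genPi (is : List ℕ) (A : Term) : Term :=
  is.foldr (fun i B => .cpi Lvl (B.rename id (captureRen i))) A

/-- `i₁ … iₖ. t`, binding the free level variables `i₁, …, iₖ` of `t`. -/
def genLam (is : List ℕ) (t : Term) : Term :=
  is.foldr (fun i u => .clam (u.rename id (captureRen i))) t

/-- The level substitution mapping the variables in `X` to `0`. -/
def zeroOn (X : Finset ℕ) : LevelSubst := fun n => if n ∈ X then .zero else .var n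

/-- `is` lists, without repetition, the elements of `X`. -/
def Enumerates (is : List ℕ) (X : Finset ℕ) : Prop := is.Nodup ∧ ∀ i, i ∈ is ↔ i ∈ X

end UPP

/-!
The crux is that reduction preserves typing, which rests on confluence modulo `≃`. Reduction and
`≃` are treated at once through parallel reduction modulo `≃`, which has the diamond property
because the root rules are left-linear and their left-hand sides contain no level constructors, so
that `≃` never creates or destroys a redex. Confluence makes function types, and the types
`Tm l (Π l₁ l₂ A B)`, injective up to `≡`; subject reduction follows, the rule for `@` included,
although its left-hand side does not force the two families of parameters to agree.

A derivation of the elaborator is then read with a unifier `θ` applied throughout: emitted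
constraints become instances of `≃`, and weak head reduction commutes with `θ`, so the judgment
becomes a typing derivation. Composing `θ` with any further typed level substitution gives another
unifier, hence `t[θ]` and `A[θ]` are typed generically in their level variables. The variables of
`A[θ]` may therefore be abstracted and the remaining ones set to `0`.
-/

namespace UPP

/-! ### Substitution calculus -/

namespace Level

theorem subst_subst (θ θ' : LevelSubst) (l : Level) :
    (l.subst θ).subst θ' = l.subst fun i => (θ i).subst θ' := by
  induction l <;> simp_all [subst]

@[simp] theorem subst_var (l : Level) : l.subst .var = l := by
  induction l <;> simp_all [subst]

@[simp] theorem rename_id (l : Level) : l.rename id = l := subst_var l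

theorem rename_subst (ξ : ℕ → ℕ) (θ : LevelSubst) (l : Level) :
    (l.rename ξ).subst θ = l.subst fun i => θ (ξ i) :=
  subst_subst _ _ l

theorem rename_rename (ξ ξ' : ℕ → ℕ) (l : Level) :
    (l.rename ξ).rename ξ' = l.rename fun i => ξ' (ξ i) :=
  subst_subst _ _ l

theorem subst_rename (θ : LevelSubst) (ξ : ℕ → ℕ) (l : Level) :
    (l.subst θ).rename ξ = l.subst fun i => (θ i).rename ξ :=
  subst_subst _ _ l

theorem subst_congr_fv {θ θ' : LevelSubst} {l : Level} (h : ∀ i ∈ l.fv, θ i = θ' i) :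
    l.subst θ = l.subst θ' := by
  induction l <;> simp_all [subst, fv]

end Level

namespace LevelSubst

@[simp] theorem up_var : LevelSubst.up .var = .var := by
  funext n; cases n <;> rfl

@[simp] theorem up_rename (ξ : ℕ → ℕ) :
    LevelSubst.up (fun i => .var (ξ i)) = fun i => .var (upRen ξ i) := by
  funext n; cases n <;> rfl

theorem up_upRen (ξ : ℕ → ℕ) (θ : LevelSubst) :
    (fun i => θ.up (upRen ξ i)) = LevelSubst.up fun i => θ (ξ i) := by
  funext n; cases n <;> rfl

theorem up_rename_upRen (ξ : ℕ → ℕ) (θ : LevelSubst) :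
    (fun i => (θ.up i).rename (upRen ξ)) = LevelSubst.up fun i => (θ i).rename ξ := by
  funext n
  cases n with
  | zero => rfl
  | succ n => simp only [up, Level.rename_rename, upRen]

theorem up_subst_up (θ θ' : LevelSubst) :
    (fun i => (θ.up i).subst θ'.up) = LevelSubst.up fun i => (θ i).subst θ' := by
  funext n
  cases n with
  | zero => rfl
  | succ n => simp only [up, Level.rename_subst, Level.subst_rename]

/-- The substitution mapping the variable `0` to `l` and each later variable `i + 1` to `θ i`. -/
def cons (l : Level) (θ : LevelSubst) : LevelSubst
  | 0 => l
  | i + 1 => θ i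

end LevelSubst

@[simp] theorem upSubst_var : upSubst .var = .var := by
  funext n; cases n <;> rfl

@[simp] theorem upSubst_rename (ρ : ℕ → ℕ) :
    upSubst (fun x => .var (ρ x)) = fun x => .var (upRen ρ x) := by
  funext n; cases n <;> rfl

theorem upSubst_upRen (ρ : ℕ → ℕ) (σ : ℕ → Term) :
    (fun x => upSubst σ (upRen ρ x)) = upSubst fun x => σ (ρ x) := by
  funext n; cases n <;> rfl

namespace Term

theorem rename_eq_subst (ρ ξ : ℕ → ℕ) (t : Term) :
    t.rename ρ ξ = t.subst (fun x => .var (ρ x)) (fun i => .var (ξ i)) := by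
  induction t generalizing ρ ξ <;> simp_all [rename, subst, Level.rename, cshift]

@[simp] theorem subst_var (t : Term) : t.subst .var .var = t := by
  induction t <;> simp_all [subst, cshift, rename]

theorem rename_subst (ρ ξ : ℕ → ℕ) (σ : ℕ → Term) (θ : LevelSubst) (t : Term) :
    (t.rename ρ ξ).subst σ θ = t.subst (fun x => σ (ρ x)) (fun i => θ (ξ i)) := by
  induction t generalizing ρ ξ σ θ <;>
    simp_all [rename, subst, Level.rename_subst, upSubst_upRen, LevelSubst.up_upRen]

theorem rename_rename (ρ ξ ρ' ξ' : ℕ → ℕ) (t : Term) :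
    (t.rename ρ ξ).rename ρ' ξ' = t.rename (fun x => ρ' (ρ x)) (fun i => ξ' (ξ i)) := by
  rw [rename_eq_subst ρ' ξ', rename_subst, rename_eq_subst]

theorem shift_rename (ρ ξ : ℕ → ℕ) (t : Term) :
    t.shift.rename (upRen ρ) ξ = (t.rename ρ ξ).shift := by
  simp only [shift, rename_rename]; rfl

theorem cshift_rename (ρ ξ : ℕ → ℕ) (t : Term) :
    t.cshift.rename ρ (upRen ξ) = (t.rename ρ ξ).cshift := by
  simp only [cshift, rename_rename]; rfl

theorem upSubst_rename_upRen (ρ ξ : ℕ → ℕ) (σ : ℕ → Term) :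
    (fun x => (upSubst σ x).rename (upRen ρ) ξ) = upSubst fun x => (σ x).rename ρ ξ := by
  funext n
  cases n with
  | zero => rfl
  | succ n => exact shift_rename ρ ξ (σ n)

theorem subst_rename (ρ ξ : ℕ → ℕ) (σ : ℕ → Term) (θ : LevelSubst) (t : Term) :
    (t.subst σ θ).rename ρ ξ =
      t.subst (fun x => (σ x).rename ρ ξ) (fun i => (θ i).rename ξ) := by
  induction t generalizing ρ ξ σ θ <;>
    simp_all [rename, subst, Level.subst_rename, cshift_rename, upSubst_rename_upRen,
      LevelSubst.up_rename_upRen]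

theorem shift_subst (σ : ℕ → Term) (θ : LevelSubst) (t : Term) :
    t.shift.subst (upSubst σ) θ = (t.subst σ θ).shift := by
  simp [shift, rename_subst, subst_rename, upSubst]

theorem cshift_subst (σ : ℕ → Term) (θ : LevelSubst) (t : Term) :
    t.cshift.subst (fun x => (σ x).cshift) θ.up = (t.subst σ θ).cshift := by
  simp only [cshift, rename_subst, subst_rename]; rfl

theorem upSubst_subst_upSubst (σ σ' : ℕ → Term) (θ : LevelSubst) :
    (fun x => (upSubst σ x).subst (upSubst σ') θ) = upSubst fun x => (σ x).subst σ' θ := by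
  funext n
  cases n with
  | zero => rfl
  | succ n => exact shift_subst σ' θ (σ n)

theorem subst_subst (σ σ' : ℕ → Term) (θ θ' : LevelSubst) (t : Term) :
    (t.subst σ θ).subst σ' θ' =
      t.subst (fun x => (σ x).subst σ' θ') (fun i => (θ i).subst θ') := by
  induction t generalizing σ σ' θ θ' <;>
    simp_all [subst, Level.subst_subst, cshift_subst, upSubst_subst_upSubst,
      LevelSubst.up_subst_up]

theorem lsubst_lsubst (θ θ' : LevelSubst) (t : Term) :
    (t.lsubst θ).lsubst θ' = t.lsubst fun i => (θ i).subst θ' :=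
  subst_subst _ _ _ _ t

/-- The substitution mapping the variable `0` to `u` and each later variable `x + 1` to `σ x`. -/
def cons (u : Term) (σ : ℕ → Term) : ℕ → Term
  | 0 => u
  | x + 1 => σ x

theorem inst_eq (B u : Term) : B.inst u = B.subst (cons u .var) .var := by
  rw [inst]; congr

theorem cinst_eq (B : Term) (l : Level) : B.cinst l = B.subst .var (.cons l .var) := by
  rw [cinst, lsubst]; congr

@[simp] theorem shift_inst (t u : Term) : t.shift.inst u = t := by
  simp only [inst_eq, shift, rename_subst]; exact subst_var t

@[simp] theorem cshift_cinst (t : Term) (l : Level) : t.cshift.cinst l = t := by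
  simp only [cinst_eq, cshift, rename_subst]; exact subst_var t

theorem subst_upSubst_inst (σ : ℕ → Term) (θ : LevelSubst) (B u : Term) :
    (B.subst (upSubst σ) θ).inst u = B.subst (cons u σ) θ := by
  simp only [inst_eq, subst_subst, Level.subst_var]
  congr 1
  funext n
  cases n with
  | zero => rfl
  | succ n => exact (inst_eq _ _).symm.trans (shift_inst (σ n) _)

theorem inst_subst (σ : ℕ → Term) (θ : LevelSubst) (B u : Term) :
    (B.inst u).subst σ θ = (B.subst (upSubst σ) θ).inst (u.subst σ θ) := by
  rw [subst_upSubst_inst, inst_eq, subst_subst]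
  congr 1
  funext n; cases n <;> rfl

theorem subst_up_cinst (σ : ℕ → Term) (θ : LevelSubst) (B : Term) (l : Level) :
    (B.subst (fun x => (σ x).cshift) θ.up).cinst l = B.subst σ (.cons l θ) := by
  simp only [cinst_eq, subst_subst]
  congr 1
  · funext x
    rw [← cinst_eq, cshift_cinst]
  · funext n
    cases n with
    | zero => rfl
    | succ n => exact (Level.rename_subst _ _ _).trans (Level.subst_var _)

theorem cinst_subst (σ : ℕ → Term) (θ : LevelSubst) (B : Term) (l : Level) :
    (B.cinst l).subst σ θ =
      (B.subst (fun x => (σ x).cshift) θ.up).cinst (l.subst θ) := by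
  rw [subst_up_cinst, cinst_eq, subst_subst]
  congr 1
  funext n; cases n <;> rfl

theorem inst_rename (ρ ξ : ℕ → ℕ) (B u : Term) :
    (B.inst u).rename ρ ξ = (B.rename (upRen ρ) ξ).inst (u.rename ρ ξ) := by
  simp [rename_eq_subst, inst_subst]

theorem cinst_rename (ρ ξ : ℕ → ℕ) (B : Term) (l : Level) :
    (B.cinst l).rename ρ ξ = (B.rename ρ (upRen ξ)).cinst (l.rename ξ) := by
  simp only [rename_eq_subst, cinst_subst, LevelSubst.up_rename]; rfl

theorem lsubst_pi (θ : LevelSubst) (A B : Term) :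
    (Term.pi A B).lsubst θ = .pi (A.lsubst θ) (B.lsubst θ) := by
  simp [lsubst, subst]

theorem lsubst_lam (θ : LevelSubst) (t : Term) :
    (Term.lam t).lsubst θ = .lam (t.lsubst θ) := by
  simp [lsubst, subst]

theorem lsubst_inst (θ : LevelSubst) (B u : Term) :
    (B.inst u).lsubst θ = (B.lsubst θ).inst (u.lsubst θ) := by
  simp [lsubst, inst_subst]

end Term

/-! ### Equivalence of levels and conversion -/

theorem LevelEq.subst_congr (l : Level) {θ θ' : LevelSubst} (hθ : ∀ i, LevelEq (θ i) (θ' i)) :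
    LevelEq (l.subst θ) (l.subst θ') := by
  induction l with
  | var i => exact hθ i
  | zero => exact .refl _
  | succ l ih => exact .succ ih
  | max l l' ih ih' => exact .max ih ih'

theorem LevelEq.subst {l l' : Level} (h : LevelEq l l') (θ : LevelSubst) :
    LevelEq (l.subst θ) (l'.subst θ) := by
  induction h with
  | refl l => exact .refl _
  | symm _ ih => exact .symm ih
  | trans _ _ ih ih' => exact .trans ih ih'
  | succ _ ih => exact .succ ih
  | max _ _ ih ih' => exact .max ih ih'
  | max_assoc l₁ l₂ l₃ => exact .max_assoc _ _ _
  | max_comm l₁ l₂ => exact .max_comm _ _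
  | succ_max l₁ l₂ => exact .succ_max _ _
  | max_succ_self l => exact .max_succ_self _
  | max_zero l => exact .max_zero _
  | max_self l => exact .max_self _

theorem LevelEq.rename {l l' : Level} (h : LevelEq l l') (ξ : ℕ → ℕ) :
    LevelEq (l.rename ξ) (l'.rename ξ) :=
  h.subst _

theorem LevelEq.subst_subst {l l' : Level} (h : LevelEq l l') {θ θ' : LevelSubst}
    (hθ : ∀ i, LevelEq (θ i) (θ' i)) : LevelEq (l.subst θ) (l'.subst θ') :=
  (h.subst θ).trans (.subst_congr l' hθ)

theorem LevelEq.up {θ θ' : LevelSubst} (hθ : ∀ i, LevelEq (θ i) (θ' i)) :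
    ∀ i, LevelEq (θ.up i) (θ'.up i)
  | 0 => .refl _
  | i + 1 => (hθ i).rename _

theorem TermEq.refl (t : Term) : TermEq t t := by
  induction t <;> constructor <;> first | assumption | exact .refl _

namespace Conv

variable {Φ Φ' : LocalSig} {A A' B B' t t' u u' v : Term}

theorem refl (t : Term) : Conv Φ t t := Relation.EqvGen.refl t

theorem symm (h : Conv Φ t u) : Conv Φ u t := Relation.EqvGen.symm _ _ h

theorem trans (h : Conv Φ t u) (h' : Conv Φ u v) : Conv Φ t v :=
  Relation.EqvGen.trans _ _ _ h h'

theorem step (h : Step Φ t u) : Conv Φ t u := .rel _ _ (.inl h)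

theorem root (h : RootStep Φ t u) : Conv Φ t u := .step (.root h)

theorem termEq (h : TermEq t u) : Conv Φ t u := .rel _ _ (.inr h)

theorem steps (h : Steps Φ t u) : Conv Φ t u := by
  induction h with
  | refl => exact .refl _
  | tail _ h ih => exact ih.trans (.step h)

theorem lift {f : Term → Term} (hf : ∀ {t u}, Step Φ t u ∨ TermEq t u → Conv Φ' (f t) (f u))
    (h : Conv Φ t u) : Conv Φ' (f t) (f u) := by
  induction h with
  | rel _ _ h => exact hf h
  | refl => exact .refl _
  | symm _ _ _ ih => exact ih.symm
  | trans _ _ _ _ _ ih ih' => exact ih.trans ih'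

theorem map {f : Term → Term} (hs : ∀ {t u}, Step Φ t u → Step Φ (f t) (f u))
    (he : ∀ {t u}, TermEq t u → TermEq (f t) (f u)) (h : Conv Φ t u) : Conv Φ (f t) (f u) :=
  h.lift fun h => .rel _ _ (h.imp hs he)

theorem pi (hA : Conv Φ A A') (hB : Conv Φ B B') : Conv Φ (.pi A B) (.pi A' B') :=
  (hA.map (f := (.pi · B)) .pi_left (.pi · (.refl _))).trans (hB.map .pi_right (.pi (.refl _) ·))

theorem cpi (hA : Conv Φ A A') (hB : Conv Φ B B') : Conv Φ (.cpi A B) (.cpi A' B') :=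
  (hA.map (f := (.cpi · B)) .cpi_left (.cpi · (.refl _))).trans
    (hB.map .cpi_right (.cpi (.refl _) ·))

theorem app (ht : Conv Φ t t') (hu : Conv Φ u u') : Conv Φ (.app t u) (.app t' u') :=
  (ht.map (f := (.app · u)) .app_left (.app · (.refl _))).trans
    (hu.map .app_right (.app (.refl _) ·))

theorem lam (h : Conv Φ t t') : Conv Φ (.lam t) (.lam t') := h.map .lam .lam

theorem clam (h : Conv Φ t t') : Conv Φ (.clam t) (.clam t') := h.map .clam .clam

theorem capp {l l' : Level} (h : Conv Φ t t') (hl : LevelEq l l') :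
    Conv Φ (.capp t l) (.capp t' l') :=
  (h.map (f := (.capp · l)) .capp (.capp · (.refl _))).trans (.termEq (.capp (.refl _) hl))

end Conv

/-! ### Parallel reduction -/

/-- Parallel reduction modulo `≃`: contracts any set of redexes that do not overlap, and may
replace levels by equivalent ones. It is the diamond property of this relation that gives the
confluence of `⟶` modulo `≃`. -/
inductive Par (Φ : LocalSig) : Term → Term → Prop
  | var (x) : Par Φ (.var x) (.var x)
  | const (c) : Par Φ (.const c) (.const c)
  | sort (s) : Par Φ (.sort s) (.sort s)
  | pi {A A' B B'} : Par Φ A A' → Par Φ B B' → Par Φ (.pi A B) (.pi A' B')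
  | lam {t t'} : Par Φ t t' → Par Φ (.lam t) (.lam t')
  | app {t t' u u'} : Par Φ t t' → Par Φ u u' → Par Φ (.app t u) (.app t' u')
  | cpi {A A' B B'} : Par Φ A A' → Par Φ B B' → Par Φ (.cpi A B) (.cpi A' B')
  | clam {t t'} : Par Φ t t' → Par Φ (.clam t) (.clam t')
  | capp {t t' l l'} : Par Φ t t' → LevelEq l l' → Par Φ (.capp t l) (.capp t' l')
  | beta {t t' u u'} : Par Φ t t' → Par Φ u u' → Par Φ (.app (.lam t) u) (t'.inst u')
  | cbeta {t t' l l'} : Par Φ t t' → LevelEq l l' → Par Φ (.capp (.clam t) l) (t'.cinst l')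
  | tm_univ {l₀ l l'} : LevelEq l l' → Par Φ (Tm l₀ (U l)) (Ty l')
  | app_abs {l₁ l₂ A B l₃ l₄ A' B' t t' u u'} : Par Φ t t' → Par Φ u u' →
      Par Φ (App l₁ l₂ A B (Abs l₃ l₄ A' B' t) u) (.app t' u')
  | delta {c A t} : (⟨c, A, some t⟩ : Entry) ∈ Φ → Par Φ (.const (.user c)) t

/-- The properties of a local signature that the metatheory of reduction relies on: a name has at
most one definition, and definitions have closed bodies. -/
structure RedSig (Φ : LocalSig) : Prop where
  body_unique {c A t A' t'} : (⟨c, A, some t⟩ : Entry) ∈ Φ → (⟨c, A', some t'⟩ : Entry) ∈ Φ →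
    t = t'
  body_closed {c A t} : (⟨c, A, some t⟩ : Entry) ∈ Φ → ∀ σ θ, t.subst σ θ = t

namespace Par

variable {Φ : LocalSig} {t t' u u' : Term}

theorem refl (t : Term) : Par Φ t t := by
  induction t <;> constructor <;> first | assumption | exact .refl _

theorem of_root (h : RootStep Φ t u) : Par Φ t u := by
  cases h with
  | beta t u => exact .beta (.refl _) (.refl _)
  | cbeta t l => exact .cbeta (.refl _) (.refl _)
  | tm_univ => exact .tm_univ (.refl _)
  | app_abs => exact .app_abs (.refl _) (.refl _)
  | delta h => exact .delta h

theorem of_step (h : Step Φ t u) : Par Φ t u := by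
  induction h with
  | root h => exact .of_root h
  | pi_left _ ih => exact .pi ih (.refl _)
  | pi_right _ ih => exact .pi (.refl _) ih
  | lam _ ih => exact .lam ih
  | app_left _ ih => exact .app ih (.refl _)
  | app_right _ ih => exact .app (.refl _) ih
  | cpi_left _ ih => exact .cpi ih (.refl _)
  | cpi_right _ ih => exact .cpi (.refl _) ih
  | clam _ ih => exact .clam ih
  | capp _ ih => exact .capp ih (.refl _)

theorem of_termEq (h : TermEq t u) : Par Φ t u := by
  induction h <;> constructor <;> assumption

theorem of_step_or_termEq (h : Step Φ t u ∨ TermEq t u) : Par Φ t u :=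
  h.elim of_step of_termEq

theorem conv (h : Par Φ t u) : Conv Φ t u := by
  induction h with
  | var | const | sort => exact .refl _
  | pi _ _ ih ih' => exact .pi ih ih'
  | lam _ ih => exact .lam ih
  | app _ _ ih ih' => exact .app ih ih'
  | cpi _ _ ih ih' => exact .cpi ih ih'
  | clam _ ih => exact .clam ih
  | capp _ hl ih => exact .capp ih hl
  | beta _ _ ih ih' => exact (Conv.app (.lam ih) ih').trans (.root (.beta _ _))
  | cbeta _ hl ih => exact (Conv.capp (.clam ih) hl).trans (.root (.cbeta _ _))
  | tm_univ hl => exact (Conv.root (.tm_univ _ _)).trans (.capp (.refl _) hl)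
  | app_abs _ _ ih ih' => exact (Conv.root (.app_abs ..)).trans (.app ih ih')
  | delta h => exact .root (.delta h)

theorem rename (hΦ : RedSig Φ) (h : Par Φ t u) (ρ ξ : ℕ → ℕ) :
    Par Φ (t.rename ρ ξ) (u.rename ρ ξ) := by
  induction h generalizing ρ ξ with
  | var | const | sort => exact .refl _
  | pi _ _ ih ih' => exact .pi (ih ..) (ih' ..)
  | lam _ ih => exact .lam (ih ..)
  | app _ _ ih ih' => exact .app (ih ..) (ih' ..)
  | cpi _ _ ih ih' => exact .cpi (ih ..) (ih' ..)
  | clam _ ih => exact .clam (ih ..)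
  | capp _ hl ih => exact .capp (ih ..) (hl.rename _)
  | beta _ _ ih ih' => rw [Term.inst_rename]; exact .beta (ih ..) (ih' ..)
  | cbeta _ hl ih => rw [Term.cinst_rename]; exact .cbeta (ih ..) (hl.rename _)
  | tm_univ hl => exact .tm_univ (hl.rename _)
  | app_abs _ _ ih ih' => exact .app_abs (ih ..) (ih' ..)
  | delta h =>
    rw [Term.rename_eq_subst, Term.rename_eq_subst, hΦ.body_closed h]
    exact .delta h

theorem upSubst (hΦ : RedSig Φ) {σ σ' : ℕ → Term} (hσ : ∀ x, Par Φ (σ x) (σ' x)) :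
    ∀ x, Par Φ (UPP.upSubst σ x) (UPP.upSubst σ' x)
  | 0 => .refl _
  | x + 1 => (hσ x).rename hΦ _ _

theorem subst (hΦ : RedSig Φ) (h : Par Φ t u) {σ σ' : ℕ → Term} {θ θ' : LevelSubst}
    (hσ : ∀ x, Par Φ (σ x) (σ' x)) (hθ : ∀ i, LevelEq (θ i) (θ' i)) :
    Par Φ (t.subst σ θ) (u.subst σ' θ') := by
  have cshift {σ σ' : ℕ → Term} (hσ : ∀ x, Par Φ (σ x) (σ' x)) (x : ℕ) :
      Par Φ (σ x).cshift (σ' x).cshift := (hσ x).rename hΦ _ _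
  induction h generalizing σ σ' θ θ' with
  | var => exact hσ _
  | const | sort => exact .refl _
  | pi _ _ ih ih' => exact .pi (ih hσ hθ) (ih' (.upSubst hΦ hσ) hθ)
  | lam _ ih => exact .lam (ih (.upSubst hΦ hσ) hθ)
  | app _ _ ih ih' => exact .app (ih hσ hθ) (ih' hσ hθ)
  | cpi _ _ ih ih' => exact .cpi (ih hσ hθ) (ih' (cshift hσ) (.up hθ))
  | clam _ ih => exact .clam (ih (cshift hσ) (.up hθ))
  | capp _ hl ih => exact .capp (ih hσ hθ) (hl.subst_subst hθ)
  | beta _ _ ih ih' =>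
    rw [Term.inst_subst]; exact .beta (ih (.upSubst hΦ hσ) hθ) (ih' hσ hθ)
  | cbeta _ hl ih =>
    rw [Term.cinst_subst]; exact .cbeta (ih (cshift hσ) (.up hθ)) (hl.subst_subst hθ)
  | tm_univ hl => exact .tm_univ (hl.subst_subst hθ)
  | app_abs _ _ ih ih' => exact .app_abs (ih hσ hθ) (ih' hσ hθ)
  | delta h => rw [hΦ.body_closed h]; exact .delta h

theorem inst (hΦ : RedSig Φ) (ht : Par Φ t t') (hu : Par Φ u u') :
    Par Φ (t.inst u) (t'.inst u') := by
  rw [Term.inst_eq, Term.inst_eq]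
  refine ht.subst hΦ ?_ fun _ => .refl _
  rintro (_ | x)
  exacts [hu, .refl _]

theorem cinst (hΦ : RedSig Φ) {l l' : Level} (ht : Par Φ t t') (hl : LevelEq l l') :
    Par Φ (t.cinst l) (t'.cinst l') := by
  rw [Term.cinst_eq, Term.cinst_eq]
  refine ht.subst hΦ (fun _ => .refl _) ?_
  rintro (_ | x)
  exacts [hl, .refl _]

theorem lam_inv (h : Par Φ (.lam t) u) : ∃ t', u = .lam t' ∧ Par Φ t t' := by
  cases h with | lam h => exact ⟨_, rfl, h⟩

theorem clam_inv (h : Par Φ (.clam t) u) : ∃ t', u = .clam t' ∧ Par Φ t t' := by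
  cases h with | clam h => exact ⟨_, rfl, h⟩

theorem tm_inv {l : Level} (h : Par Φ (.capp (.const .tm) l) u) :
    ∃ l', u = .capp (.const .tm) l' ∧ LevelEq l l' := by
  cases h with | capp h hl => cases h; exact ⟨_, rfl, hl⟩

theorem univ_inv {l : Level} (h : Par Φ (U l) u) : ∃ l', u = U l' ∧ LevelEq l l' := by
  cases h with | capp h hl => cases h; exact ⟨_, rfl, hl⟩

theorem prod_inv {l l' : Level} {A B : Term} (h : Par Φ (Prod l l' A B) u) :
    ∃ m m' A' B', u = Prod m m' A' B' ∧ LevelEq l m ∧ LevelEq l' m' ∧ Par Φ A A' ∧ Par Φ B B' := by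
  cases h with | app h hB => cases h with | app h hA =>
  cases h with | capp h hl' => cases h with | capp h hl =>
  cases h
  exact ⟨_, _, _, _, rfl, hl, hl', hA, hB⟩

theorem abs_inv {l l' : Level} {A B : Term} (h : Par Φ (Abs l l' A B t) u) :
    ∃ m m' A' B' t', u = Abs m m' A' B' t' ∧ Par Φ t t' := by
  cases h with | app h ht => cases h with | app h _ => cases h with | app h _ =>
  cases h with | capp h _ => cases h with | capp h _ =>
  cases h
  exact ⟨_, _, _, _, _, rfl, ht⟩

theorem app_inv {l l' : Level} {A B : Term}
    (h : Par Φ (.app (.app (.app (.capp (.capp (.const .app) l) l') A) B) t) u) :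
    ∃ m m' A' B' t', u = .app (.app (.app (.capp (.capp (.const .app) m) m') A') B') t' ∧
      Par Φ t t' := by
  cases h with | app h ht => cases h with | app h _ => cases h with | app h _ =>
  cases h with | capp h _ => cases h with | capp h _ =>
  cases h
  exact ⟨_, _, _, _, _, rfl, ht⟩

/-! ### Confluence -/

/-- The diamond property of parallel reduction at the source `s`. -/
def DiamondAt (Φ : LocalSig) (s : Term) : Prop :=
  ∀ ⦃t u⦄, Par Φ s t → Par Φ s u → Relation.Join (Par Φ) t u

namespace DiamondAt

variable {f a : Term} {l : Level}

theorem of_lam (h : DiamondAt Φ (.lam t)) : DiamondAt Φ t := fun _ _ h₁ h₂ => by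
  obtain ⟨v, k₁, k₂⟩ := h (.lam h₁) (.lam h₂)
  obtain ⟨t', rfl, ht₁⟩ := k₁.lam_inv
  obtain ⟨_, ⟨⟩, ht₂⟩ := k₂.lam_inv
  exact ⟨t', ht₁, ht₂⟩

theorem of_clam (h : DiamondAt Φ (.clam t)) : DiamondAt Φ t := fun _ _ h₁ h₂ => by
  obtain ⟨v, k₁, k₂⟩ := h (.clam h₁) (.clam h₂)
  obtain ⟨t', rfl, ht₁⟩ := k₁.clam_inv
  obtain ⟨_, ⟨⟩, ht₂⟩ := k₂.clam_inv
  exact ⟨t', ht₁, ht₂⟩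

theorem of_app_abs {l₁ l₂ l₃ l₄ : Level} {A B A' B' : Term}
    (h : DiamondAt Φ (.app (.app (.app (.capp (.capp (.const .app) l₁) l₂) A) B)
      (Abs l₃ l₄ A' B' t))) : DiamondAt Φ t := fun _ _ h₁ h₂ => by
  obtain ⟨v, k₁, k₂⟩ := h (.app (.refl _) (.app (.refl _) h₁)) (.app (.refl _) (.app (.refl _) h₂))
  obtain ⟨_, _, _, _, _, rfl, habs₁⟩ := k₁.app_inv
  obtain ⟨_, _, _, _, _, ⟨⟩, habs₂⟩ := k₂.app_inv
  obtain ⟨_, _, _, _, t', rfl, ht₁⟩ := habs₁.abs_inv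
  obtain ⟨_, _, _, _, _, ⟨⟩, ht₂⟩ := habs₂.abs_inv
  exact ⟨t', ht₁, ht₂⟩

theorem join_beta (hΦ : RedSig Φ) (dt : DiamondAt Φ t) (da : DiamondAt Φ a) {f' a' t' a'' : Term}
    (hf : Par Φ (.lam t) f') (ha : Par Φ a a') (ht : Par Φ t t') (ha' : Par Φ a a'') :
    Relation.Join (Par Φ) (.app f' a') (t'.inst a'') := by
  obtain ⟨_, rfl, ht'⟩ := hf.lam_inv
  obtain ⟨v, hv, hv'⟩ := dt ht' ht
  obtain ⟨w, hw, hw'⟩ := da ha ha'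
  exact ⟨_, .beta hv hw, hv'.inst hΦ hw'⟩

theorem join_cbeta (hΦ : RedSig Φ) (dt : DiamondAt Φ t) {f' t' : Term} {l' l'' : Level}
    (hf : Par Φ (.clam t) f') (hl : LevelEq l l') (ht : Par Φ t t') (hl' : LevelEq l l'') :
    Relation.Join (Par Φ) (.capp f' l') (t'.cinst l'') := by
  obtain ⟨_, rfl, ht'⟩ := hf.clam_inv
  obtain ⟨v, hv, hv'⟩ := dt ht' ht
  exact ⟨_, .cbeta hv (hl.symm.trans hl'), hv'.cinst hΦ (.refl _)⟩

theorem join_app_abs (dt : DiamondAt Φ t) (da : DiamondAt Φ a) {l₁ l₂ l₃ l₄ : Level}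
    {A B A' B' f' a' t' a'' : Term}
    (hf : Par Φ (.app (.app (.app (.capp (.capp (.const .app) l₁) l₂) A) B)
      (Abs l₃ l₄ A' B' t)) f')
    (ha : Par Φ a a') (ht : Par Φ t t') (ha' : Par Φ a a'') :
    Relation.Join (Par Φ) (.app f' a') (.app t' a'') := by
  obtain ⟨_, _, _, _, _, rfl, habs⟩ := hf.app_inv
  obtain ⟨_, _, _, _, _, rfl, ht'⟩ := habs.abs_inv
  obtain ⟨v, hv, hv'⟩ := dt ht' ht
  obtain ⟨w, hw, hw'⟩ := da ha ha'
  exact ⟨_, .app_abs hv hw, .app hv' hw'⟩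

theorem join_tm_univ {l₀ l' : Level} {f' a' : Term} (hf : Par Φ (.capp (.const .tm) l₀) f')
    (ha : Par Φ (U l) a') (hl : LevelEq l l') : Relation.Join (Par Φ) (.app f' a') (Ty l') := by
  obtain ⟨_, rfl, -⟩ := hf.tm_inv
  obtain ⟨_, rfl, hl'⟩ := ha.univ_inv
  exact ⟨_, .tm_univ (hl'.symm.trans hl), .refl _⟩

theorem app (hΦ : RedSig Φ) (df : DiamondAt Φ f) (da : DiamondAt Φ a) :
    DiamondAt Φ (.app f a) := by
  intro s₁ s₂ h₁ h₂
  cases h₁ with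
  | app hf₁ ha₁ =>
    cases h₂ with
    | app hf₂ ha₂ =>
      obtain ⟨v, hv₁, hv₂⟩ := df hf₁ hf₂
      obtain ⟨w, hw₁, hw₂⟩ := da ha₁ ha₂
      exact ⟨_, .app hv₁ hw₁, .app hv₂ hw₂⟩
    | beta ht₂ ha₂ => exact join_beta hΦ df.of_lam da hf₁ ha₁ ht₂ ha₂
    | tm_univ hl₂ => exact join_tm_univ hf₁ ha₁ hl₂
    | app_abs ht₂ ha₂ => exact join_app_abs df.of_app_abs da hf₁ ha₁ ht₂ ha₂
  | beta ht₁ ha₁ =>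
    cases h₂ with
    | app hf₂ ha₂ => exact symm (join_beta hΦ df.of_lam da hf₂ ha₂ ht₁ ha₁)
    | beta ht₂ ha₂ =>
      obtain ⟨v, hv₁, hv₂⟩ := df.of_lam ht₁ ht₂
      obtain ⟨w, hw₁, hw₂⟩ := da ha₁ ha₂
      exact ⟨_, hv₁.inst hΦ hw₁, hv₂.inst hΦ hw₂⟩
  | tm_univ hl₁ =>
    cases h₂ with
    | app hf₂ ha₂ => exact symm (join_tm_univ hf₂ ha₂ hl₁)
    | tm_univ hl₂ => exact ⟨_, .refl _, .capp (.refl _) (hl₂.symm.trans hl₁)⟩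
  | app_abs ht₁ ha₁ =>
    cases h₂ with
    | app hf₂ ha₂ => exact symm (join_app_abs df.of_app_abs da hf₂ ha₂ ht₁ ha₁)
    | app_abs ht₂ ha₂ =>
      obtain ⟨v, hv₁, hv₂⟩ := df.of_app_abs ht₁ ht₂
      obtain ⟨w, hw₁, hw₂⟩ := da ha₁ ha₂
      exact ⟨_, .app hv₁ hw₁, .app hv₂ hw₂⟩

theorem capp (hΦ : RedSig Φ) (df : DiamondAt Φ f) : DiamondAt Φ (.capp f l) := by
  intro s₁ s₂ h₁ h₂
  cases h₁ with
  | capp hf₁ hl₁ =>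
    cases h₂ with
    | capp hf₂ hl₂ =>
      obtain ⟨v, hv₁, hv₂⟩ := df hf₁ hf₂
      exact ⟨_, .capp hv₁ hl₁.symm, .capp hv₂ hl₂.symm⟩
    | cbeta ht₂ hl₂ => exact join_cbeta hΦ df.of_clam hf₁ hl₁ ht₂ hl₂
  | cbeta ht₁ hl₁ =>
    cases h₂ with
    | capp hf₂ hl₂ => exact symm (join_cbeta hΦ df.of_clam hf₂ hl₂ ht₁ hl₁)
    | cbeta ht₂ hl₂ =>
      obtain ⟨v, hv₁, hv₂⟩ := df.of_clam ht₁ ht₂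
      exact ⟨_, hv₁.cinst hΦ (.refl _), hv₂.cinst hΦ (hl₂.symm.trans hl₁)⟩

theorem const (hΦ : RedSig Φ) (c : Const) : DiamondAt Φ (.const c) := by
  intro s₁ s₂ h₁ h₂
  cases h₁ with
  | const => exact ⟨_, h₂, .refl _⟩
  | delta h =>
    cases h₂ with
    | const => exact ⟨_, .refl _, .delta h⟩
    | delta h' => cases hΦ.body_unique h h'; exact ⟨_, .refl _, .refl _⟩

end DiamondAt

theorem diamond (hΦ : RedSig Φ) (s : Term) : DiamondAt Φ s := by
  induction s with
  | var | sort => rintro _ _ ⟨⟩ h₂; exact ⟨_, h₂, .refl _⟩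
  | const c => exact .const hΦ c
  | pi A B ihA ihB =>
    intro _ _ h₁ h₂
    cases h₁ with | pi hA₁ hB₁ => cases h₂ with | pi hA₂ hB₂ =>
    obtain ⟨_, h₁, h₂⟩ := ihA hA₁ hA₂
    obtain ⟨_, k₁, k₂⟩ := ihB hB₁ hB₂
    exact ⟨_, .pi h₁ k₁, .pi h₂ k₂⟩
  | cpi A B ihA ihB =>
    intro _ _ h₁ h₂
    cases h₁ with | cpi hA₁ hB₁ => cases h₂ with | cpi hA₂ hB₂ =>
    obtain ⟨_, h₁, h₂⟩ := ihA hA₁ hA₂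
    obtain ⟨_, k₁, k₂⟩ := ihB hB₁ hB₂
    exact ⟨_, .cpi h₁ k₁, .cpi h₂ k₂⟩
  | lam t ih =>
    intro _ _ h₁ h₂
    cases h₁ with | lam ht₁ => cases h₂ with | lam ht₂ =>
    obtain ⟨_, h₁, h₂⟩ := ih ht₁ ht₂
    exact ⟨_, .lam h₁, .lam h₂⟩
  | clam t ih =>
    intro _ _ h₁ h₂
    cases h₁ with | clam ht₁ => cases h₂ with | clam ht₂ =>
    obtain ⟨_, h₁, h₂⟩ := ih ht₁ ht₂
    exact ⟨_, .clam h₁, .clam h₂⟩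
  | app f a ihf iha => exact .app hΦ ihf iha
  | capp f l ih => exact .capp hΦ ih

end Par

namespace Conv

variable {Φ : LocalSig} {t u : Term}

theorem join (hΦ : RedSig Φ) (h : Conv Φ t u) :
    Relation.Join (Relation.ReflTransGen (Par Φ)) t u := by
  have join_equivalence : Equivalence (Relation.Join (Relation.ReflTransGen (Par Φ))) :=
    Relation.equivalence_join_reflTransGen fun _ _ _ hb hc =>
      let ⟨d, h₁, h₂⟩ := Par.diamond hΦ _ hb hc
      ⟨d, .single h₁, .single h₂⟩
  exact join_equivalence.eqvGen_iff.1 <| Relation.EqvGen.mono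
    (fun _ _ h => ⟨_, .single (.of_step_or_termEq h), .refl⟩) _ _ h

theorem subst (hΦ : RedSig Φ) (h : Conv Φ t u) (σ : ℕ → Term) (θ : LevelSubst) :
    Conv Φ (t.subst σ θ) (u.subst σ θ) :=
  h.lift fun h => (Par.subst hΦ (.of_step_or_termEq h) (fun _ => .refl _) fun _ => .refl _).conv

theorem rename (hΦ : RedSig Φ) (h : Conv Φ t u) (ρ ξ : ℕ → ℕ) :
    Conv Φ (t.rename ρ ξ) (u.rename ρ ξ) := by
  rw [Term.rename_eq_subst, Term.rename_eq_subst]; exact h.subst hΦ _ _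

theorem inst (hΦ : RedSig Φ) {B B' : Term} (hB : Conv Φ B B') (hu : Conv Φ t u) :
    Conv Φ (B.inst t) (B'.inst u) := by
  have hB' : Conv Φ (B.inst t) (B'.inst t) := by
    rw [Term.inst_eq, Term.inst_eq]; exact hB.subst hΦ _ _
  exact hB'.trans (hu.lift fun h => (Par.inst hΦ (.refl B') (.of_step_or_termEq h)).conv)

theorem cinst (hΦ : RedSig Φ) (h : Conv Φ t u) (l : Level) : Conv Φ (t.cinst l) (u.cinst l) := by
  rw [Term.cinst_eq, Term.cinst_eq]; exact h.subst hΦ _ _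

end Conv

/-! ### Injectivity of type constructors -/

section Injectivity

variable {Φ : LocalSig} {A A' B B' u : Term}

theorem pi_inv_of_pars (h : Relation.ReflTransGen (Par Φ) (.pi A B) u) :
    ∃ A' B', u = .pi A' B' ∧ Conv Φ A A' ∧ Conv Φ B B' := by
  induction h with
  | refl => exact ⟨_, _, rfl, .refl _, .refl _⟩
  | tail _ h ih =>
    obtain ⟨_, _, rfl, hA, hB⟩ := ih
    cases h with | pi hA' hB' => exact ⟨_, _, rfl, hA.trans hA'.conv, hB.trans hB'.conv⟩

theorem cpi_inv_of_pars (h : Relation.ReflTransGen (Par Φ) (.cpi A B) u) :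
    ∃ A' B', u = .cpi A' B' ∧ Conv Φ A A' ∧ Conv Φ B B' := by
  induction h with
  | refl => exact ⟨_, _, rfl, .refl _, .refl _⟩
  | tail _ h ih =>
    obtain ⟨_, _, rfl, hA, hB⟩ := ih
    cases h with | cpi hA' hB' => exact ⟨_, _, rfl, hA.trans hA'.conv, hB.trans hB'.conv⟩

theorem tm_prod_inv_of_pars {m l l' : Level}
    (h : Relation.ReflTransGen (Par Φ) (Tm m (Prod l l' A B)) u) :
    ∃ m₁ l₁ l₁' A₁ B₁, u = Tm m₁ (Prod l₁ l₁' A₁ B₁) ∧ LevelEq l l₁ ∧ LevelEq l' l₁' ∧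
      Conv Φ A A₁ ∧ Conv Φ B B₁ := by
  induction h with
  | refl => exact ⟨_, _, _, _, _, rfl, .refl _, .refl _, .refl _, .refl _⟩
  | tail _ h ih =>
    obtain ⟨_, _, _, _, _, rfl, hl, hl', hA, hB⟩ := ih
    cases h with | app htm hprod =>
    obtain ⟨_, rfl, -⟩ := htm.tm_inv
    obtain ⟨_, _, _, _, rfl, hm, hm', hA', hB'⟩ := hprod.prod_inv
    exact ⟨_, _, _, _, _, rfl, hl.trans hm, hl'.trans hm', hA.trans hA'.conv, hB.trans hB'.conv⟩

theorem Conv.pi_inj (hΦ : RedSig Φ) (h : Conv Φ (.pi A B) (.pi A' B')) :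
    Conv Φ A A' ∧ Conv Φ B B' := by
  obtain ⟨v, h₁, h₂⟩ := h.join hΦ
  obtain ⟨_, _, rfl, hA₁, hB₁⟩ := pi_inv_of_pars h₁
  obtain ⟨_, _, ⟨⟩, hA₂, hB₂⟩ := pi_inv_of_pars h₂
  exact ⟨hA₁.trans hA₂.symm, hB₁.trans hB₂.symm⟩

theorem Conv.cpi_inj (hΦ : RedSig Φ) (h : Conv Φ (.cpi A B) (.cpi A' B')) :
    Conv Φ A A' ∧ Conv Φ B B' := by
  obtain ⟨v, h₁, h₂⟩ := h.join hΦ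
  obtain ⟨_, _, rfl, hA₁, hB₁⟩ := cpi_inv_of_pars h₁
  obtain ⟨_, _, ⟨⟩, hA₂, hB₂⟩ := cpi_inv_of_pars h₂
  exact ⟨hA₁.trans hA₂.symm, hB₁.trans hB₂.symm⟩

theorem Conv.tm_prod_inj (hΦ : RedSig Φ) {m l l' m₁ l₁ l₁' : Level}
    (h : Conv Φ (Tm m (Prod l l' A B)) (Tm m₁ (Prod l₁ l₁' A' B'))) :
    LevelEq l l₁ ∧ LevelEq l' l₁' ∧ Conv Φ A A' ∧ Conv Φ B B' := by
  obtain ⟨v, h₁, h₂⟩ := h.join hΦ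
  obtain ⟨_, _, _, _, _, rfl, hl₁, hl₁', hA₁, hB₁⟩ := tm_prod_inv_of_pars h₁
  obtain ⟨_, _, _, _, _, ⟨⟩, hl₂, hl₂', hA₂, hB₂⟩ := tm_prod_inv_of_pars h₂
  exact ⟨hl₁.trans hl₂.symm, hl₁'.trans hl₂'.symm, hA₁.trans hA₂.symm, hB₁.trans hB₂.symm⟩

end Injectivity

/-! ### Stability of reduction under substitution -/

section Substitution

variable {Φ : LocalSig} {t u : Term}

theorem RootStep.subst (hΦ : RedSig Φ) (h : RootStep Φ t u) (σ : ℕ → Term) (θ : LevelSubst) :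
    RootStep Φ (t.subst σ θ) (u.subst σ θ) := by
  cases h with
  | beta t u => rw [Term.inst_subst]; exact .beta _ _
  | cbeta t l => rw [Term.cinst_subst]; exact .cbeta _ _
  | tm_univ => exact .tm_univ _ _
  | app_abs => exact .app_abs ..
  | delta h => rw [hΦ.body_closed h]; exact .delta h

theorem Step.subst (hΦ : RedSig Φ) (h : Step Φ t u) (σ : ℕ → Term) (θ : LevelSubst) :
    Step Φ (t.subst σ θ) (u.subst σ θ) := by
  induction h generalizing σ θ with
  | root h => exact .root (h.subst hΦ σ θ)
  | pi_left _ ih => exact .pi_left (ih ..)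
  | pi_right _ ih => exact .pi_right (ih ..)
  | lam _ ih => exact .lam (ih ..)
  | app_left _ ih => exact .app_left (ih ..)
  | app_right _ ih => exact .app_right (ih ..)
  | cpi_left _ ih => exact .cpi_left (ih ..)
  | cpi_right _ ih => exact .cpi_right (ih ..)
  | clam _ ih => exact .clam (ih ..)
  | capp _ ih => exact .capp (ih ..)

theorem Steps.lsubst (hΦ : RedSig Φ) (h : Steps Φ t u) (θ : LevelSubst) :
    Steps Φ (t.lsubst θ) (u.lsubst θ) :=
  Relation.ReflTransGen.lift (Term.lsubst θ) (fun _ _ h => h.subst hΦ .var θ) _ _ h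

end Substitution

/-! ### Typing: renaming and substitution -/

mutual

theorem HasType.wfCtx {Φ Γ t A} : HasType Φ Γ t A → WfCtx Φ Γ
  | .sort h | .var h _ | .const h _ => h
  | .conv h _ _ | .pi h _ | .cpi h _ | .lam h _ _ | .clam h _ _ | .app h _ | .capp h _ => h.wfCtx

theorem HasCType.wfCtx {Φ Γ l A} : HasCType Φ Γ l A → WfCtx Φ Γ
  | .var h _ | .zero h => h
  | .succ h | .max h _ | .conv h _ _ => h.wfCtx

end

/-- The substitution `σ`, `θ` is the identity on the variables declared in `Γ`. -/
structure FixesVars (σ : ℕ → Term) (θ : LevelSubst) (Γ : Ctx) : Prop where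
  reg {x A} : Lookup Γ x A → σ x = .var x
  conf {i A} : CLookup Γ i A → θ i = .var i

theorem FixesVars.up_reg {σ θ Γ} (h : FixesVars σ θ Γ) (A : Term) :
    FixesVars (upSubst σ) θ (.reg A :: Γ) where
  reg := by
    rintro _ _ (_ | h' | _)
    · rfl
    · simp only [upSubst, h.reg h', Term.shift, Term.rename]
  conf := by
    rintro _ _ (_ | _ | h')
    exact h.conf h'

theorem FixesVars.up_conf {σ θ Γ} (h : FixesVars σ θ Γ) (A : Term) :
    FixesVars (fun x => (σ x).cshift) θ.up (.conf A :: Γ) where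
  reg := by
    rintro _ _ (_ | _ | h')
    simp only [h.reg h', Term.cshift, Term.rename, id]
  conf := by
    rintro _ _ (_ | h' | _)
    · rfl
    · simp only [LevelSubst.up, h.conf h', Level.rename, Level.subst]

mutual

theorem HasType.subst_eq {Φ Γ t A} :
    HasType Φ Γ t A → ∀ {σ θ}, FixesVars σ θ Γ → t.subst σ θ = t
  | .sort _, _, _, _ | .const _ _, _, _, _ => rfl
  | .var _ h, _, _, hf => hf.reg h
  | .conv h _ _, _, _, hf => h.subst_eq hf
  | .pi hA hB, _, _, hf => by rw [Term.subst, hA.subst_eq hf, hB.subst_eq (hf.up_reg _)]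
  | .lam _ _ ht, _, _, hf => by rw [Term.subst, ht.subst_eq (hf.up_reg _)]
  | .cpi hA hB, _, _, hf => by rw [Term.subst, hA.subst_eq hf, hB.subst_eq (hf.up_conf _)]
  | .clam _ _ ht, _, _, hf => by rw [Term.subst, ht.subst_eq (hf.up_conf _)]
  | .app ht hu, _, _, hf => by rw [Term.subst, ht.subst_eq hf, hu.subst_eq hf]
  | .capp ht hl, _, _, hf => by rw [Term.subst, ht.subst_eq hf, hl.subst_eq hf]

theorem HasCType.subst_eq {Φ Γ l A} :
    HasCType Φ Γ l A → ∀ {σ θ}, FixesVars σ θ Γ → l.subst θ = l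
  | .var _ h, _, _, hf => hf.conf h
  | .zero _, _, _, _ => rfl
  | .succ h, _, _, hf => by rw [Level.subst, h.subst_eq hf]
  | .max h h', _, _, hf => by rw [Level.subst, h.subst_eq hf, h'.subst_eq hf]
  | .conv h _ _, _, _, hf => h.subst_eq hf

end

theorem HasType.closed {Φ t A} (h : HasType Φ [] t A) (σ : ℕ → Term) (θ : LevelSubst) :
    t.subst σ θ = t :=
  h.subst_eq ⟨nofun, nofun⟩

/-- `A` can stand on the right of `:` in `Γ`: it is `Kind`, or it is typed by a sort. -/
def IsType (Φ : LocalSig) (Γ : Ctx) (A : Term) : Prop :=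
  A = .sort .kind ∨ ∃ s, HasType Φ Γ A (.sort s)

theorem HasType.isType {Φ Γ A s} (h : HasType Φ Γ A (.sort s)) : IsType Φ Γ A := .inr ⟨s, h⟩

theorem IsType.closed {Φ A} (h : IsType Φ [] A) (σ : ℕ → Term) (θ : LevelSubst) :
    A.subst σ θ = A := by
  obtain rfl | ⟨s, h⟩ := h
  exacts [rfl, h.closed σ θ]

/-- Well-formedness of a local signature in UPP, in a form that refers to the whole of `Φ` rather
than to the entries preceding each entry; see `WfSig.valid`. -/
structure ValidSig (Φ : LocalSig) : Prop where
  name_inj : Set.InjOn Entry.name {e | e ∈ Φ}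
  type_valid {e : Entry} : e ∈ Φ → IsType Φ [] e.type
  body_typed {c A t} : (⟨c, A, some t⟩ : Entry) ∈ Φ → HasType Φ [] t A

section Typing

variable {Φ : LocalSig}

theorem ValidSig.redSig (hΦ : ValidSig Φ) : RedSig Φ where
  body_unique h h' := by cases hΦ.name_inj h h' rfl; rfl
  body_closed h := (hΦ.body_typed h).closed

theorem HasConst.closed (hΦ : ValidSig Φ) {c A} (h : HasConst Φ c A) (σ : ℕ → Term)
    (θ : LevelSubst) : A.subst σ θ = A := by
  cases h with
  | user h => exact (hΦ.type_valid h).closed σ θ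
  | _ => rfl

/-- The renaming `ρ`, `ξ` maps the variables declared in `Γ` to variables declared in `Δ` with the
renamed type. -/
structure RenTyped (ρ ξ : ℕ → ℕ) (Γ Δ : Ctx) : Prop where
  reg {x A} : Lookup Γ x A → Lookup Δ (ρ x) (A.rename ρ ξ)
  conf {i A} : CLookup Γ i A → CLookup Δ (ξ i) (A.rename ρ ξ)

namespace RenTyped

variable {ρ ξ : ℕ → ℕ} {Γ Δ : Ctx}

theorem up_reg (h : RenTyped ρ ξ Γ Δ) (A : Term) :
    RenTyped (upRen ρ) ξ (.reg A :: Γ) (.reg (A.rename ρ ξ) :: Δ) where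
  reg := by
    rintro _ _ (_ | h' | _) <;> rw [Term.shift_rename]
    · exact .here
    · exact .reg (h.reg h')
  conf := by
    rintro _ _ (_ | _ | h')
    rw [Term.shift_rename]
    exact .reg (h.conf h')

theorem up_conf (h : RenTyped ρ ξ Γ Δ) (A : Term) :
    RenTyped ρ (upRen ξ) (.conf A :: Γ) (.conf (A.rename ρ ξ) :: Δ) where
  reg := by
    rintro _ _ (_ | _ | h')
    rw [Term.cshift_rename]
    exact .conf (h.reg h')
  conf := by
    rintro _ _ (_ | h' | _) <;> rw [Term.cshift_rename]
    · exact .here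
    · exact .conf (h.conf h')

theorem shift (Γ : Ctx) (A : Term) : RenTyped Nat.succ id Γ (.reg A :: Γ) :=
  ⟨.reg, .reg⟩

theorem cshift (Γ : Ctx) (A : Term) : RenTyped id Nat.succ Γ (.conf A :: Γ) :=
  ⟨.conf, .conf⟩

end RenTyped

mutual

theorem HasType.rename (hΦ : ValidSig Φ) {Γ t A} : HasType Φ Γ t A → ∀ {ρ ξ Δ},
    RenTyped ρ ξ Γ Δ → WfCtx Φ Δ → HasType Φ Δ (t.rename ρ ξ) (A.rename ρ ξ)
  | .sort _, _, _, _, _, hΔ => .sort hΔ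
  | .var _ h, _, _, _, hr, hΔ => .var hΔ (hr.reg h)
  | .const _ h, _, _, _, _, hΔ => by
    rw [Term.rename_eq_subst _ _ A, h.closed hΦ]; exact .const hΔ h
  | .conv h h' hc, _, _, _, hr, hΔ =>
    .conv (h.rename hΦ hr hΔ) (h'.rename hΦ hr hΔ) (hc.rename hΦ.redSig _ _)
  | .pi hA hB, _, _, _, hr, hΔ =>
    have hA' := hA.rename hΦ hr hΔ
    .pi hA' (hB.rename hΦ (hr.up_reg _) (.reg hA'))
  | .cpi hA hB, _, _, _, hr, hΔ =>
    have hA' := hA.rename hΦ hr hΔ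
    .cpi hA' (hB.rename hΦ (hr.up_conf _) (.conf hA'))
  | .lam hA hB ht, _, _, _, hr, hΔ =>
    have hA' := hA.rename hΦ hr hΔ
    .lam hA' (hB.rename hΦ (hr.up_reg _) (.reg hA')) (ht.rename hΦ (hr.up_reg _) (.reg hA'))
  | .clam hA hB ht, _, _, _, hr, hΔ =>
    have hA' := hA.rename hΦ hr hΔ
    .clam hA' (hB.rename hΦ (hr.up_conf _) (.conf hA')) (ht.rename hΦ (hr.up_conf _) (.conf hA'))
  | .app ht hu, _, _, _, hr, hΔ => by
    rw [Term.inst_rename]; exact .app (ht.rename hΦ hr hΔ) (hu.rename hΦ hr hΔ)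
  | .capp ht hl, _, _, _, hr, hΔ => by
    rw [Term.cinst_rename]; exact .capp (ht.rename hΦ hr hΔ) (hl.rename hΦ hr hΔ)

theorem HasCType.rename (hΦ : ValidSig Φ) {Γ l A} : HasCType Φ Γ l A → ∀ {ρ ξ Δ},
    RenTyped ρ ξ Γ Δ → WfCtx Φ Δ → HasCType Φ Δ (l.rename ξ) (A.rename ρ ξ)
  | .var _ h, _, _, _, hr, hΔ => .var hΔ (hr.conf h)
  | .zero _, _, _, _, _, hΔ => .zero hΔ
  | .succ h, _, _, _, hr, hΔ => .succ (h.rename hΦ hr hΔ)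
  | .max h h', _, _, _, hr, hΔ => .max (h.rename hΦ hr hΔ) (h'.rename hΦ hr hΔ)
  | .conv h h' hc, _, _, _, hr, hΔ =>
    .conv (h.rename hΦ hr hΔ) (h'.rename hΦ hr hΔ) (hc.rename hΦ.redSig _ _)

end

theorem HasType.of_nil (hΦ : ValidSig Φ) {Γ t A} (h : HasType Φ [] t A) (hΓ : WfCtx Φ Γ)
    (hA : ∀ σ θ, A.subst σ θ = A) : HasType Φ Γ t A := by
  have := h.rename hΦ (ρ := id) (ξ := id) (Δ := Γ) ⟨nofun, nofun⟩ hΓ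
  rwa [Term.rename_eq_subst, h.closed, Term.rename_eq_subst, hA] at this

theorem ValidSig.body_hasType (hΦ : ValidSig Φ) {Γ c A t} (h : (⟨c, A, some t⟩ : Entry) ∈ Φ)
    (hΓ : WfCtx Φ Γ) : HasType Φ Γ t A :=
  (hΦ.body_typed h).of_nil hΦ hΓ (hΦ.type_valid h).closed

/-- The substitution `σ`, `θ` maps the variables declared in `Γ` to terms and levels that have the
substituted type in `Δ`. -/
structure SubTyped (Φ : LocalSig) (σ : ℕ → Term) (θ : LevelSubst) (Γ Δ : Ctx) : Prop where
  reg {x A} : Lookup Γ x A → HasType Φ Δ (σ x) (A.subst σ θ)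
  conf {i A} : CLookup Γ i A → HasCType Φ Δ (θ i) (A.subst σ θ)

namespace SubTyped

variable {σ : ℕ → Term} {θ : LevelSubst} {Γ Δ : Ctx} {A A' u : Term}

theorem up_reg (hΦ : ValidSig Φ) (h : SubTyped Φ σ θ Γ Δ)
    (hA : HasType Φ Δ (A.subst σ θ) (.sort .type)) :
    SubTyped Φ (upSubst σ) θ (.reg A :: Γ) (.reg (A.subst σ θ) :: Δ) where
  reg := by
    rintro _ _ (_ | h' | _) <;> rw [Term.shift_subst]
    · exact .var (.reg hA) .here
    · exact (h.reg h').rename hΦ (.shift _ _) (.reg hA)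
  conf := by
    rintro i _ (_ | _ | h')
    rw [Term.shift_subst, ← Level.rename_id (θ i)]
    exact (h.conf h').rename hΦ (.shift _ _) (.reg hA)

theorem up_conf (hΦ : ValidSig Φ) (h : SubTyped Φ σ θ Γ Δ)
    (hA : HasType Φ Δ (A.subst σ θ) (.sort .type)) :
    SubTyped Φ (fun x => (σ x).cshift) θ.up (.conf A :: Γ) (.conf (A.subst σ θ) :: Δ) where
  reg := by
    rintro _ _ (_ | _ | h')
    rw [Term.cshift_subst]
    exact (h.reg h').rename hΦ (.cshift _ _) (.conf hA)
  conf := by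
    rintro _ _ (_ | h' | _) <;> rw [Term.cshift_subst]
    · exact .var (.conf hA) .here
    · exact (h.conf h').rename hΦ (.cshift _ _) (.conf hA)

theorem inst (hu : HasType Φ Γ u A) : SubTyped Φ (.cons u .var) .var (.reg A :: Γ) Γ where
  reg := by
    rintro _ _ (_ | h | _) <;> rw [← Term.inst_eq, Term.shift_inst]
    · exact hu
    · exact .var hu.wfCtx h
  conf := by
    rintro _ _ (_ | _ | h)
    rw [← Term.inst_eq, Term.shift_inst]
    exact .var hu.wfCtx h

theorem cinst {l : Level} (hl : HasCType Φ Γ l A) :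
    SubTyped Φ .var (.cons l .var) (.conf A :: Γ) Γ where
  reg := by
    rintro _ _ (_ | _ | h)
    rw [← Term.cinst_eq, Term.cshift_cinst]
    exact .var hl.wfCtx h
  conf := by
    rintro _ _ (_ | h | _) <;> rw [← Term.cinst_eq, Term.cshift_cinst]
    · exact hl
    · exact .var hl.wfCtx h

theorem conv_reg (hΦ : ValidSig Φ) (hA : HasType Φ Γ A (.sort .type))
    (hA' : HasType Φ Γ A' (.sort .type)) (hc : Conv Φ A A') :
    SubTyped Φ .var .var (.reg A :: Γ) (.reg A' :: Γ) where
  reg := by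
    rintro _ _ (_ | h | _) <;> rw [Term.subst_var]
    · exact .conv (.var (.reg hA') .here) (hA.rename hΦ (.shift _ _) (.reg hA'))
        (hc.symm.rename hΦ.redSig _ _)
    · exact .var (.reg hA') (.reg h)
  conf := by
    rintro _ _ (_ | _ | h)
    rw [Term.subst_var]
    exact .var (.reg hA') (.reg h)

theorem conv_conf (hΦ : ValidSig Φ) (hA : HasType Φ Γ A (.sort .type))
    (hA' : HasType Φ Γ A' (.sort .type)) (hc : Conv Φ A A') :
    SubTyped Φ .var .var (.conf A :: Γ) (.conf A' :: Γ) where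
  reg := by
    rintro _ _ (_ | _ | h)
    rw [Term.subst_var]
    exact .var (.conf hA') (.conf h)
  conf := by
    rintro _ _ (_ | h | _) <;> rw [Term.subst_var]
    · exact .conv (.var (.conf hA') .here) (hA.rename hΦ (.cshift _ _) (.conf hA'))
        (hc.symm.rename hΦ.redSig _ _)
    · exact .var (.conf hA') (.conf h)

end SubTyped

mutual

theorem HasType.subst (hΦ : ValidSig Φ) {Γ t A} : HasType Φ Γ t A → ∀ {σ θ Δ},
    SubTyped Φ σ θ Γ Δ → WfCtx Φ Δ → HasType Φ Δ (t.subst σ θ) (A.subst σ θ)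
  | .sort _, _, _, _, _, hΔ => .sort hΔ
  | .var _ h, _, _, _, hr, _ => hr.reg h
  | .const _ h, _, _, _, _, hΔ => by
    rw [h.closed hΦ]; exact .const hΔ h
  | .conv h h' hc, _, _, _, hr, hΔ =>
    .conv (h.subst hΦ hr hΔ) (h'.subst hΦ hr hΔ) (hc.subst hΦ.redSig _ _)
  | .pi hA hB, _, _, _, hr, hΔ =>
    have hA' := hA.subst hΦ hr hΔ
    .pi hA' (hB.subst hΦ (hr.up_reg hΦ hA') (.reg hA'))
  | .cpi hA hB, _, _, _, hr, hΔ =>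
    have hA' := hA.subst hΦ hr hΔ
    .cpi hA' (hB.subst hΦ (hr.up_conf hΦ hA') (.conf hA'))
  | .lam hA hB ht, _, _, _, hr, hΔ =>
    have hA' := hA.subst hΦ hr hΔ
    .lam hA' (hB.subst hΦ (hr.up_reg hΦ hA') (.reg hA'))
      (ht.subst hΦ (hr.up_reg hΦ hA') (.reg hA'))
  | .clam hA hB ht, _, _, _, hr, hΔ =>
    have hA' := hA.subst hΦ hr hΔ
    .clam hA' (hB.subst hΦ (hr.up_conf hΦ hA') (.conf hA'))
      (ht.subst hΦ (hr.up_conf hΦ hA') (.conf hA'))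
  | .app ht hu, _, _, _, hr, hΔ => by
    rw [Term.inst_subst]; exact .app (ht.subst hΦ hr hΔ) (hu.subst hΦ hr hΔ)
  | .capp ht hl, _, _, _, hr, hΔ => by
    rw [Term.cinst_subst]; exact .capp (ht.subst hΦ hr hΔ) (hl.subst hΦ hr hΔ)

theorem HasCType.subst (hΦ : ValidSig Φ) {Γ l A} : HasCType Φ Γ l A → ∀ {σ θ Δ},
    SubTyped Φ σ θ Γ Δ → WfCtx Φ Δ → HasCType Φ Δ (l.subst θ) (A.subst σ θ)
  | .var _ h, _, _, _, hr, _ => hr.conf h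
  | .zero _, _, _, _, _, hΔ => .zero hΔ
  | .succ h, _, _, _, hr, hΔ => .succ (h.subst hΦ hr hΔ)
  | .max h h', _, _, _, hr, hΔ => .max (h.subst hΦ hr hΔ) (h'.subst hΦ hr hΔ)
  | .conv h h' hc, _, _, _, hr, hΔ =>
    .conv (h.subst hΦ hr hΔ) (h'.subst hΦ hr hΔ) (hc.subst hΦ.redSig _ _)

end

variable {Γ : Ctx} {A A' B t u : Term}

theorem HasType.inst (hΦ : ValidSig Φ) (h : HasType Φ (.reg A :: Γ) t B)
    (hu : HasType Φ Γ u A) : HasType Φ Γ (t.inst u) (B.inst u) := by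
  rw [Term.inst_eq, Term.inst_eq]
  exact h.subst hΦ (.inst hu) hu.wfCtx

theorem HasType.cinst (hΦ : ValidSig Φ) {l : Level} (h : HasType Φ (.conf A :: Γ) t B)
    (hl : HasCType Φ Γ l A) : HasType Φ Γ (t.cinst l) (B.cinst l) := by
  rw [Term.cinst_eq, Term.cinst_eq]
  exact h.subst hΦ (.cinst hl) hl.wfCtx

theorem HasType.conv_reg (hΦ : ValidSig Φ) (h : HasType Φ (.reg A :: Γ) t B)
    (hA : HasType Φ Γ A (.sort .type)) (hA' : HasType Φ Γ A' (.sort .type)) (hc : Conv Φ A A') :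
    HasType Φ (.reg A' :: Γ) t B := by
  simpa only [Term.subst_var] using h.subst hΦ (.conv_reg hΦ hA hA' hc) (.reg hA')

theorem HasType.conv_conf (hΦ : ValidSig Φ) (h : HasType Φ (.conf A :: Γ) t B)
    (hA : HasType Φ Γ A (.sort .type)) (hA' : HasType Φ Γ A' (.sort .type)) (hc : Conv Φ A A') :
    HasType Φ (.conf A' :: Γ) t B := by
  simpa only [Term.subst_var] using h.subst hΦ (.conv_conf hΦ hA hA' hc) (.conf hA')

end Typing

/-! ### Inversion of typing -/

/-- `Γ ⊢ t : A` by a derivation whose last rule is not the conversion rule. -/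
inductive HasTypeDirect (Φ : LocalSig) : Ctx → Term → Term → Prop
  | sort {Γ} : HasTypeDirect Φ Γ (.sort .type) (.sort .kind)
  | var {Γ x A} : Lookup Γ x A → HasTypeDirect Φ Γ (.var x) A
  | const {Γ c A} : HasConst Φ c A → HasTypeDirect Φ Γ (.const c) A
  | pi {Γ A B s} : HasType Φ Γ A (.sort .type) → HasType Φ (.reg A :: Γ) B (.sort s) →
      HasTypeDirect Φ Γ (.pi A B) (.sort s)
  | cpi {Γ A B s} : HasType Φ Γ A (.sort .type) → HasType Φ (.conf A :: Γ) B (.sort s) →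
      HasTypeDirect Φ Γ (.cpi A B) (.sort s)
  | lam {Γ A B t} : HasType Φ Γ A (.sort .type) → HasType Φ (.reg A :: Γ) t B →
      HasTypeDirect Φ Γ (.lam t) (.pi A B)
  | clam {Γ A B t} : HasType Φ Γ A (.sort .type) → HasType Φ (.conf A :: Γ) t B →
      HasTypeDirect Φ Γ (.clam t) (.cpi A B)
  | app {Γ A B t u} : HasType Φ Γ t (.pi A B) → HasType Φ Γ u A →
      HasTypeDirect Φ Γ (.app t u) (B.inst u)
  | capp {Γ A B t l} : HasType Φ Γ t (.cpi A B) → HasCType Φ Γ l A →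
      HasTypeDirect Φ Γ (.capp t l) (B.cinst l)

namespace HasType

variable {Φ : LocalSig} {Γ : Ctx} {A B t u T : Term}

theorem direct {Γ t T} : HasType Φ Γ t T → ∃ T₀, HasTypeDirect Φ Γ t T₀ ∧ Conv Φ T₀ T
  | .sort _ => ⟨_, .sort, .refl _⟩
  | .var _ h => ⟨_, .var h, .refl _⟩
  | .const _ h => ⟨_, .const h, .refl _⟩
  | .conv h _ hc => let ⟨_, h, hc'⟩ := h.direct; ⟨_, h, hc'.trans hc⟩
  | .pi hA hB => ⟨_, .pi hA hB, .refl _⟩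
  | .cpi hA hB => ⟨_, .cpi hA hB, .refl _⟩
  | .lam hA _ ht => ⟨_, .lam hA ht, .refl _⟩
  | .clam hA _ ht => ⟨_, .clam hA ht, .refl _⟩
  | .app ht hu => ⟨_, .app ht hu, .refl _⟩
  | .capp ht hl => ⟨_, .capp ht hl, .refl _⟩

theorem pi_inv (h : HasType Φ Γ (.pi A B) T) :
    HasType Φ Γ A (.sort .type) ∧ ∃ s, HasType Φ (.reg A :: Γ) B (.sort s) := by
  obtain ⟨_, h, -⟩ := h.direct
  cases h with | pi hA hB => exact ⟨hA, _, hB⟩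

theorem cpi_inv (h : HasType Φ Γ (.cpi A B) T) :
    HasType Φ Γ A (.sort .type) ∧ ∃ s, HasType Φ (.conf A :: Γ) B (.sort s) := by
  obtain ⟨_, h, -⟩ := h.direct
  cases h with | cpi hA hB => exact ⟨hA, _, hB⟩

theorem lam_inv (h : HasType Φ Γ (.lam t) T) :
    ∃ A B, HasType Φ Γ A (.sort .type) ∧ HasType Φ (.reg A :: Γ) t B ∧ Conv Φ (.pi A B) T := by
  obtain ⟨_, h, hc⟩ := h.direct
  cases h with | lam hA ht => exact ⟨_, _, hA, ht, hc⟩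

theorem clam_inv (h : HasType Φ Γ (.clam t) T) :
    ∃ A B, HasType Φ Γ A (.sort .type) ∧ HasType Φ (.conf A :: Γ) t B ∧ Conv Φ (.cpi A B) T := by
  obtain ⟨_, h, hc⟩ := h.direct
  cases h with | clam hA ht => exact ⟨_, _, hA, ht, hc⟩

theorem const_inv {c : Const} (h : HasType Φ Γ (.const c) T) :
    ∃ A, HasConst Φ c A ∧ Conv Φ A T := by
  obtain ⟨_, h, hc⟩ := h.direct
  cases h with | const h => exact ⟨_, h, hc⟩

theorem app_inv (h : HasType Φ Γ (.app t u) T) :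
    ∃ A B, HasType Φ Γ t (.pi A B) ∧ HasType Φ Γ u A ∧ Conv Φ (B.inst u) T := by
  obtain ⟨_, h, hc⟩ := h.direct
  cases h with | app ht hu => exact ⟨_, _, ht, hu, hc⟩

theorem capp_inv {l : Level} (h : HasType Φ Γ (.capp t l) T) :
    ∃ A B, HasType Φ Γ t (.cpi A B) ∧ HasCType Φ Γ l A ∧ Conv Φ (B.cinst l) T := by
  obtain ⟨_, h, hc⟩ := h.direct
  cases h with | capp ht hl => exact ⟨_, _, ht, hl, hc⟩

end HasType

/-! ### The constants of UPP -/

/-- `(l l' : Lvl) → (A : Ty l) → (B : Tm l A → Ty l') → X`, the common shape of the types of the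
constants `Π`, `λ` and `@`. -/
abbrev famPi (X : Term) : Term :=
  .cpi Lvl (.cpi Lvl (.pi (Ty (.var 1)) (.pi (.pi (Tm (.var 1) (.var 0)) (Ty (.var 0))) X)))

/-- `t l l' A B`. -/
abbrev famApp (t : Term) (l l' : Level) (A B : Term) : Term :=
  .app (.app (.capp (.capp t l) l') A) B

/-- The context `Γ, l : Lvl, l' : Lvl, A : Ty l, B : Tm l A → Ty l'` of the body of `famPi`. -/
abbrev famCtx (Γ : Ctx) : Ctx :=
  .reg (.pi (Tm (.var 1) (.var 0)) (Ty (.var 0))) :: .reg (Ty (.var 1)) ::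
    .conf Lvl :: .conf Lvl :: Γ

/-- `X[l, l', A, B ↦ l, l', A, B]` for the body `X` of `famPi X`. -/
def famInst (X : Term) (l l' : Level) (A B : Term) : Term :=
  X.subst (.cons B (.cons A .var)) (.cons l' (.cons l .var))

/-- `l` and `l'` are levels, `A : Ty l` and `B : Tm l A → Ty l'` in `Γ`. -/
structure FamTyped (Φ : LocalSig) (Γ : Ctx) (l l' : Level) (A B : Term) : Prop where
  left : HasCType Φ Γ l Lvl
  right : HasCType Φ Γ l' Lvl
  base : HasType Φ Γ A (Ty l)
  family : HasType Φ Γ B (.pi (Tm l A) (Ty l'))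

section Constants

variable {Φ : LocalSig} {Γ : Ctx} {A B C X t u T : Term} {l l' : Level}

theorem HasType.app_subst {σ : ℕ → Term} {θ : LevelSubst}
    (ht : HasType Φ Γ t ((Term.pi A B).subst σ θ)) (hu : HasType Φ Γ u (A.subst σ θ)) :
    HasType Φ Γ (.app t u) (B.subst (.cons u σ) θ) := by
  rw [← Term.subst_upSubst_inst]
  exact .app ht hu

theorem HasType.capp_subst {σ : ℕ → Term} {θ : LevelSubst}
    (ht : HasType Φ Γ t ((Term.cpi A B).subst σ θ)) (hl : HasCType Φ Γ l (A.subst σ θ)) :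
    HasType Φ Γ (.capp t l) (B.subst σ (.cons l θ)) := by
  rw [← Term.subst_up_cinst]
  exact .capp ht hl

theorem HasType.famApp (ht : HasType Φ Γ t (famPi X)) (h : FamTyped Φ Γ l l' A B) :
    HasType Φ Γ (famApp t l l' A B) (famInst X l l' A B) := by
  rw [← Term.subst_var (famPi X)] at ht
  exact (((ht.capp_subst h.left).capp_subst h.right).app_subst h.base).app_subst h.family

theorem HasType.famPi {s : DkSort} (hX : HasType Φ (famCtx Γ) X (.sort s)) :
    HasType Φ Γ (famPi X) (.sort s) := by
  have .reg hB := hX.wfCtx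
  have .reg hA := hB.wfCtx
  have .conf hl' := hA.wfCtx
  have .conf hl := hl'.wfCtx
  exact .cpi hl (.cpi hl' (.pi hA (.pi hB hX)))

theorem HasType.lvl (hΓ : WfCtx Φ Γ) : HasType Φ Γ Lvl (.sort .type) := .const hΓ .lvl

theorem HasType.ty (hl : HasCType Φ Γ l Lvl) : HasType Φ Γ (Ty l) (.sort .type) :=
  .capp (.const hl.wfCtx .ty) hl

theorem HasType.tm (hl : HasCType Φ Γ l Lvl) (hA : HasType Φ Γ A (Ty l)) :
    HasType Φ Γ (Tm l A) (.sort .type) :=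
  .app (.capp (.const hl.wfCtx .tm) hl) hA

theorem HasType.prod (h : FamTyped Φ Γ l l' A B) :
    HasType Φ Γ (Prod l l' A B) (Ty (.max l l')) :=
  .famApp (X := Ty (.max (.var 1) (.var 0))) (.const h.left.wfCtx .prod) h

theorem HasType.tm_prod (h : FamTyped Φ Γ l l' A B) :
    HasType Φ Γ (Tm (.max l l') (Prod l l' A B)) (.sort .type) :=
  .tm (.max h.left h.right) (.prod h)

theorem HasType.tm_app (h : FamTyped Φ Γ l l' A B) (hu : HasType Φ Γ u (Tm l A)) :
    HasType Φ Γ (Tm l' (.app B u)) (.sort .type) :=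
  .tm h.right (by simpa [Term.inst_eq, Term.subst, Level.subst_var] using h.family.app hu)

theorem famCtx_wf (hΓ : WfCtx Φ Γ) : WfCtx Φ (famCtx Γ) := by
  have hl := WfCtx.conf (.lvl hΓ)
  have hA := WfCtx.reg (.ty (.var (.conf (.lvl hl)) (.conf .here)))
  have hT := HasType.tm (.var hA (.reg (.conf .here))) (.var hA .here)
  exact .reg (.pi hT (.ty (.var (.reg hT) (.reg (.reg .here)))))

theorem FamTyped.vars (h : WfCtx Φ (famCtx Γ)) :
    FamTyped Φ (famCtx Γ) (.var 1) (.var 0) (.var 1) (.var 0) where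
  left := .var h (.reg (.reg (.conf .here)))
  right := .var h (.reg (.reg .here))
  base := .var h (.reg .here)
  family := .var h .here

theorem FamTyped.shift (hΦ : ValidSig Φ) (h : FamTyped Φ Γ l l' A B)
    (hC : HasType Φ Γ C (.sort .type)) : FamTyped Φ (.reg C :: Γ) l l' A.shift B.shift := by
  have hC' := WfCtx.reg hC
  have hl := h.left.rename hΦ (.shift Γ C) hC'
  have hl' := h.right.rename hΦ (.shift Γ C) hC'
  have hA := h.base.rename hΦ (.shift Γ C) hC'
  have hB := h.family.rename hΦ (.shift Γ C) hC'
  simp only [Term.rename, Level.rename_id] at hl hl' hA hB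
  exact ⟨hl, hl', hA, hB⟩

theorem HasConst.isType (hΦ : ValidSig Φ) (hΓ : WfCtx Φ Γ) {c : Const} (h : HasConst Φ c A) :
    IsType Φ Γ A := by
  have hl := WfCtx.conf (.lvl hΓ)
  have hF := FamTyped.vars (famCtx_wf hΓ)
  cases h with
  | lvl => exact .inr ⟨_, .sort hΓ⟩
  | ty => exact .inr ⟨_, .cpi (.lvl hΓ) (.sort hl)⟩
  | tm =>
    have hA := HasType.ty (.var hl .here)
    exact .inr ⟨_, .cpi (.lvl hΓ) (.pi hA (.sort (.reg hA)))⟩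
  | univ => exact .inr ⟨_, .cpi (.lvl hΓ) (.ty (.succ (.var hl .here)))⟩
  | prod => exact (HasType.famPi (.ty (.max hF.left hF.right))).isType
  | abs =>
    have hA := HasType.tm hF.left hF.base
    have hB := HasType.pi hA (.tm_app (hF.shift hΦ hA) (.var (.reg hA) .here))
    exact (HasType.famPi (.pi hB (.tm_prod (hF.shift hΦ hB)))).isType
  | app =>
    have hP := HasType.tm_prod hF
    have hA := HasType.tm (hF.shift hΦ hP).left (hF.shift hΦ hP).base
    exact (HasType.famPi (.pi hP (.pi hA
      (.tm_app ((hF.shift hΦ hP).shift hΦ hA) (.var (.reg hA) .here))))).isType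
  | user h =>
    exact (hΦ.type_valid h).imp id fun ⟨s, h⟩ => ⟨s, h.of_nil hΦ hΓ fun _ _ => rfl⟩

theorem HasConst.user_inv {n : ℕ} (h : HasConst Φ (.user n) A) :
    ∃ e ∈ Φ, e.name = n ∧ e.type = A := by
  generalize hc : Const.user n = c at h
  cases h <;> cases hc
  exact ⟨_, ‹_›, rfl, rfl⟩

theorem HasConst.unique (hΦ : ValidSig Φ) {c : Const} (h : HasConst Φ c A)
    (h' : HasConst Φ c B) : A = B := by
  cases h with
  | user h =>
    obtain ⟨e, he, hn, rfl⟩ := h'.user_inv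
    rw [hΦ.name_inj h he hn.symm]
  | _ => cases h'; rfl

end Constants

/-! ### Validity of types -/

section Validity

variable {Φ : LocalSig} {Γ : Ctx} {A B t u T : Term}

theorem IsType.pi_inv (h : IsType Φ Γ (.pi A B)) :
    HasType Φ Γ A (.sort .type) ∧ ∃ s, HasType Φ (.reg A :: Γ) B (.sort s) := by
  obtain h | ⟨_, h⟩ := h
  · cases h
  · exact h.pi_inv

theorem IsType.cpi_inv (h : IsType Φ Γ (.cpi A B)) :
    HasType Φ Γ A (.sort .type) ∧ ∃ s, HasType Φ (.conf A :: Γ) B (.sort s) := by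
  obtain h | ⟨_, h⟩ := h
  · cases h
  · exact h.cpi_inv

theorem IsType.inst_sort (hΦ : ValidSig Φ) (h : IsType Φ Γ (.pi A B)) (hu : HasType Φ Γ u A) :
    ∃ s, HasType Φ Γ (B.inst u) (.sort s) :=
  h.pi_inv.2.imp fun _ hB => hB.inst hΦ hu

theorem IsType.cinst_sort (hΦ : ValidSig Φ) {l : Level} (h : IsType Φ Γ (.cpi A B))
    (hl : HasCType Φ Γ l A) : ∃ s, HasType Φ Γ (B.cinst l) (.sort s) :=
  h.cpi_inv.2.imp fun _ hB => hB.cinst hΦ hl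

theorem Lookup.hasType (hΦ : ValidSig Φ) {Γ x A} (h : Lookup Γ x A) (hΓ : WfCtx Φ Γ) :
    HasType Φ Γ A (.sort .type) := by
  induction h with
  | here => cases hΓ with | reg h => exact h.rename hΦ (.shift _ _) (.reg h)
  | reg _ ih => cases hΓ with | reg h => exact (ih h.wfCtx).rename hΦ (.shift _ _) (.reg h)
  | conf _ ih => cases hΓ with | conf h => exact (ih h.wfCtx).rename hΦ (.cshift _ _) (.conf h)

theorem HasType.type_isType (hΦ : ValidSig Φ) {Γ t A} : HasType Φ Γ t A → IsType Φ Γ A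
  | .sort _ => .inl rfl
  | .var hΓ h => (h.hasType hΦ hΓ).isType
  | .const hΓ h => h.isType hΦ hΓ
  | .conv _ h _ => h.isType
  | .pi (s := .kind) _ _ | .cpi (s := .kind) _ _ => .inl rfl
  | .pi (s := .type) h _ | .cpi (s := .type) h _ => (HasType.sort h.wfCtx).isType
  | .lam hA hB _ => (HasType.pi hA hB).isType
  | .clam hA hB _ => (HasType.cpi hA hB).isType
  | .app ht hu => .inr ((ht.type_isType hΦ).inst_sort hΦ hu)
  | .capp ht hl => .inr ((ht.type_isType hΦ).cinst_sort hΦ hl)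

end Validity

/-! ### Principal types -/

/-- `P` is a type of `t` in `Γ`, and the only one up to conversion. -/
structure Principal (Φ : LocalSig) (Γ : Ctx) (t P : Term) : Prop where
  typed : HasType Φ Γ t P
  conv {T} : HasType Φ Γ t T → Conv Φ P T

section Principal

variable {Φ : LocalSig} {Γ : Ctx} {A B X t u T : Term} {l l' : Level}

namespace Principal

theorem const (hΦ : ValidSig Φ) (hΓ : WfCtx Φ Γ) {c : Const} (h : HasConst Φ c A) :
    Principal Φ Γ (.const c) A where
  typed := .const hΓ h
  conv h' := by
    obtain ⟨_, h', hc⟩ := h'.const_inv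
    rwa [h.unique hΦ h']

theorem app_inv (hΦ : ValidSig Φ) (ht : Principal Φ Γ t (.pi A B))
    (h : HasType Φ Γ (.app t u) T) : HasType Φ Γ u A ∧ Conv Φ (B.inst u) T := by
  obtain ⟨A', B', h, hu, hc⟩ := h.app_inv
  obtain ⟨hA, hB⟩ := (ht.conv h).pi_inj hΦ.redSig
  exact ⟨.conv hu (ht.typed.type_isType hΦ).pi_inv.1 hA.symm,
    (hB.inst hΦ.redSig (.refl u)).trans hc⟩

theorem capp_inv (hΦ : ValidSig Φ) (ht : Principal Φ Γ t (.cpi A B))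
    (h : HasType Φ Γ (.capp t l) T) : HasCType Φ Γ l A ∧ Conv Φ (B.cinst l) T := by
  obtain ⟨A', B', h, hl, hc⟩ := h.capp_inv
  obtain ⟨hA, hB⟩ := (ht.conv h).cpi_inj hΦ.redSig
  exact ⟨.conv hl (ht.typed.type_isType hΦ).cpi_inv.1 hA.symm, (hB.cinst hΦ.redSig l).trans hc⟩

theorem app {σ : ℕ → Term} {θ : LevelSubst} (hΦ : ValidSig Φ)
    (ht : Principal Φ Γ t ((Term.pi A B).subst σ θ)) (h : HasType Φ Γ (.app t u) T) :
    HasType Φ Γ u (A.subst σ θ) ∧ Principal Φ Γ (.app t u) (B.subst (.cons u σ) θ) := by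
  have hu := (ht.app_inv hΦ h).1
  refine ⟨hu, ht.typed.app_subst hu, fun h => ?_⟩
  rw [← Term.subst_upSubst_inst]
  exact (ht.app_inv hΦ h).2

theorem capp {σ : ℕ → Term} {θ : LevelSubst} (hΦ : ValidSig Φ)
    (ht : Principal Φ Γ t ((Term.cpi A B).subst σ θ)) (h : HasType Φ Γ (.capp t l) T) :
    HasCType Φ Γ l (A.subst σ θ) ∧ Principal Φ Γ (.capp t l) (B.subst σ (.cons l θ)) := by
  have hl := (ht.capp_inv hΦ h).1
  refine ⟨hl, ht.typed.capp_subst hl, fun h => ?_⟩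
  rw [← Term.subst_up_cinst]
  exact (ht.capp_inv hΦ h).2

theorem famApp (hΦ : ValidSig Φ) (ht : Principal Φ Γ t (famPi X))
    (h : HasType Φ Γ (famApp t l l' A B) T) :
    FamTyped Φ Γ l l' A B ∧ Principal Φ Γ (UPP.famApp t l l' A B) (famInst X l l' A B) := by
  obtain ⟨_, _, hA, -⟩ := h.app_inv
  obtain ⟨_, _, hl', -⟩ := hA.app_inv
  obtain ⟨_, _, hl, -⟩ := hl'.capp_inv
  rw [← Term.subst_var (famPi X)] at ht
  obtain ⟨left, ht⟩ := Principal.capp hΦ ht hl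
  obtain ⟨right, ht⟩ := Principal.capp hΦ ht hl'
  obtain ⟨base, ht⟩ := Principal.app hΦ ht hA
  obtain ⟨family, ht⟩ := Principal.app hΦ ht h
  exact ⟨⟨left, right, base, family⟩, ht⟩

end Principal

namespace HasType

theorem uppAbs_inv (hΦ : ValidSig Φ) (h : HasType Φ Γ (Abs l l' A B t) T) :
    HasType Φ Γ t (.pi (Tm l A) (Tm l' (.app B.shift (.var 0)))) ∧
      Conv Φ (Tm (.max l l') (Prod l l' A B)) T := by
  obtain ⟨_, _, h', -⟩ := h.app_inv
  obtain ⟨-, p⟩ := Principal.famApp hΦ (.const hΦ h.wfCtx .abs) h'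
  obtain ⟨ht, p⟩ := Principal.app hΦ p h
  exact ⟨ht, p.conv h⟩

theorem uppApp_inv (hΦ : ValidSig Φ) (h : HasType Φ Γ (App l l' A B t u) T) :
    HasType Φ Γ t (Tm (.max l l') (Prod l l' A B)) ∧ HasType Φ Γ u (Tm l A) ∧
      Conv Φ (Tm l' (.app B u)) T := by
  obtain ⟨_, _, h₁, -⟩ := h.app_inv
  obtain ⟨_, _, h₀, -⟩ := h₁.app_inv
  obtain ⟨-, p⟩ := Principal.famApp hΦ (.const hΦ h.wfCtx .app) h₀
  obtain ⟨ht, p⟩ := Principal.app hΦ p h₁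
  obtain ⟨hu, p⟩ := Principal.app hΦ p h
  exact ⟨ht, hu, p.conv h⟩

theorem tm_univ_inv (hΦ : ValidSig Φ) (h : HasType Φ Γ (Tm l' (U l)) T) :
    HasCType Φ Γ l Lvl ∧ Conv Φ (.sort .type) T := by
  obtain ⟨_, _, h', hu, -⟩ := h.app_inv
  have p := Principal.const hΦ h.wfCtx .tm
  rw [← Term.subst_var (.cpi _ _)] at p
  obtain ⟨-, p⟩ := p.capp hΦ h'
  obtain ⟨-, p⟩ := p.app hΦ h
  exact ⟨((Principal.const hΦ h.wfCtx .univ).capp_inv hΦ hu).1, p.conv h⟩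

end HasType

end Principal

/-! ### Subject reduction -/

section SubjectReduction

variable {Φ : LocalSig} {Γ : Ctx} {A B t t' u T : Term} {s : DkSort}

theorem Steps.sort_inv (h : Steps Φ (.sort s) t) : t = .sort s := by
  induction h with
  | refl => rfl
  | tail _ h ih => subst ih; cases h with | root h => cases h

namespace HasType

theorem beta (hΦ : ValidSig Φ) (h : HasType Φ Γ (.app (.lam t) u) T)
    (hT : HasType Φ Γ T (.sort s)) : HasType Φ Γ (t.inst u) T := by
  obtain ⟨A, B, h, hu, hc⟩ := h.app_inv
  obtain ⟨A', B', hA', ht, hc'⟩ := h.lam_inv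
  obtain ⟨hA, hB⟩ := hc'.pi_inj hΦ.redSig
  exact .conv (ht.inst hΦ (.conv hu hA' hA.symm)) hT ((hB.inst hΦ.redSig (.refl u)).trans hc)

theorem cbeta (hΦ : ValidSig Φ) {l : Level} (h : HasType Φ Γ (.capp (.clam t) l) T)
    (hT : HasType Φ Γ T (.sort s)) : HasType Φ Γ (t.cinst l) T := by
  obtain ⟨A, B, h, hl, hc⟩ := h.capp_inv
  obtain ⟨A', B', hA', ht, hc'⟩ := h.clam_inv
  obtain ⟨hA, hB⟩ := hc'.cpi_inj hΦ.redSig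
  exact .conv (ht.cinst hΦ (.conv hl hA' hA.symm)) hT ((hB.cinst hΦ.redSig l).trans hc)

theorem app_abs (hΦ : ValidSig Φ) {l l' l'' l''' : Level} {A' B' : Term}
    (h : HasType Φ Γ (App l l' A B (Abs l'' l''' A' B' t) u) T) (hT : HasType Φ Γ T (.sort s)) :
    HasType Φ Γ (.app t u) T := by
  obtain ⟨ht, hu, hc⟩ := h.uppApp_inv hΦ
  obtain ⟨ht, hc'⟩ := ht.uppAbs_inv hΦ
  obtain ⟨hl, hl', hA, hB⟩ := hc'.tm_prod_inj hΦ.redSig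
  have hu : HasType Φ Γ u (Tm l'' A') :=
    .conv hu (ht.type_isType hΦ).pi_inv.1 (.app (.capp (.refl _) hl.symm) hA.symm)
  have htu : HasType Φ Γ (.app t u) (Tm l''' (.app (B'.shift.inst u) u)) := by
    simpa only [Term.inst_eq, Term.subst, Level.subst_var, Term.cons] using ht.app hu
  rw [Term.shift_inst] at htu
  exact .conv htu hT (.trans (.app (.capp (.refl _) hl') (.app hB (.refl _))) hc)

theorem delta (hΦ : ValidSig Φ) {c : ℕ} (h : HasType Φ Γ (.const (.user c)) T)
    (hT : HasType Φ Γ T (.sort s)) (ht : (⟨c, A, some t⟩ : Entry) ∈ Φ) : HasType Φ Γ t T := by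
  obtain ⟨_, h, hc⟩ := h.const_inv
  cases h.unique hΦ (.user ht)
  exact .conv (hΦ.body_hasType ht hT.wfCtx) hT hc

theorem rootStep (hΦ : ValidSig Φ) (h : HasType Φ Γ t T) (hT : HasType Φ Γ T (.sort s)) :
    RootStep Φ t t' → HasType Φ Γ t' T
  | .beta _ _ => h.beta hΦ hT
  | .cbeta _ _ => h.cbeta hΦ hT
  | .tm_univ _ _ => have ⟨hl, hc⟩ := h.tm_univ_inv hΦ; .conv (.ty hl) hT hc
  | .app_abs _ _ _ _ _ _ _ _ _ _ => h.app_abs hΦ hT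
  | .delta ht => h.delta hΦ hT ht

theorem step (hΦ : ValidSig Φ) {Γ t t' T} : HasType Φ Γ t T → Step Φ t t' → HasType Φ Γ t' T
  | .sort _, .root h => nomatch h
  | .var _ _, .root h => nomatch h
  | .const hΓ hc, .root (.delta h) => by
    cases hc.unique hΦ (.user h)
    exact hΦ.body_hasType h hΓ
  | .conv ht hT hc, h => .conv (ht.step hΦ h) hT hc
  | .pi hA hB, .pi_left h =>
    have hA' := hA.step hΦ h
    .pi hA' (hB.conv_reg hΦ hA hA' (.step h))
  | .pi hA hB, .pi_right h => .pi hA (hB.step hΦ h)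
  | .cpi hA hB, .cpi_left h =>
    have hA' := hA.step hΦ h
    .cpi hA' (hB.conv_conf hΦ hA hA' (.step h))
  | .cpi hA hB, .cpi_right h => .cpi hA (hB.step hΦ h)
  | .lam hA hB ht, .lam h => .lam hA hB (ht.step hΦ h)
  | .clam hA hB ht, .clam h => .clam hA hB (ht.step hΦ h)
  | .app ht hu, .root h =>
    have ⟨_, hT⟩ := (ht.type_isType hΦ).inst_sort hΦ hu
    (HasType.app ht hu).rootStep hΦ hT h
  | .app ht hu, .app_left h => .app (ht.step hΦ h) hu
  | .app ht hu, .app_right h =>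
    have ⟨_, hT⟩ := (ht.type_isType hΦ).inst_sort hΦ hu
    .conv (.app ht (hu.step hΦ h)) hT (.inst hΦ.redSig (.refl _) (.symm (.step h)))
  | .capp ht hl, .root h =>
    have ⟨_, hT⟩ := (ht.type_isType hΦ).cinst_sort hΦ hl
    (HasType.capp ht hl).rootStep hΦ hT h
  | .capp ht hl, .capp h => .capp (ht.step hΦ h) hl

theorem steps (hΦ : ValidSig Φ) (h : HasType Φ Γ t T) (hs : Steps Φ t t') :
    HasType Φ Γ t' T := by
  induction hs with
  | refl => exact h
  | tail _ hs ih => exact ih.step hΦ hs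

theorem type_steps (hΦ : ValidSig Φ) (ht : HasType Φ Γ t A) (hs : Steps Φ A B) :
    HasType Φ Γ t B := by
  obtain rfl | ⟨_, hA⟩ := ht.type_isType hΦ
  · rwa [hs.sort_inv]
  · exact .conv ht (hA.steps hΦ hs) (.steps hs)

end HasType

end SubjectReduction

/-! ### Well-formed signatures -/

section Signatures

variable {Φ Φ' : LocalSig}

theorem HasConst.mono (hs : Φ ⊆ Φ') {c A} (h : HasConst Φ c A) : HasConst Φ' c A := by
  cases h with
  | user h => exact .user (hs h)
  | _ => constructor

theorem RootStep.mono (hs : Φ ⊆ Φ') {t u} (h : RootStep Φ t u) : RootStep Φ' t u := by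
  cases h with
  | delta h => exact .delta (hs h)
  | _ => constructor

theorem Step.mono (hs : Φ ⊆ Φ') {t u} (h : Step Φ t u) : Step Φ' t u := by
  induction h with
  | root h => exact .root (h.mono hs)
  | pi_left _ ih => exact .pi_left ih
  | pi_right _ ih => exact .pi_right ih
  | lam _ ih => exact .lam ih
  | app_left _ ih => exact .app_left ih
  | app_right _ ih => exact .app_right ih
  | cpi_left _ ih => exact .cpi_left ih
  | cpi_right _ ih => exact .cpi_right ih
  | clam _ ih => exact .clam ih
  | capp _ ih => exact .capp ih

theorem Conv.mono (hs : Φ ⊆ Φ') {t u} (h : Conv Φ t u) : Conv Φ' t u :=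
  h.lift (f := id) fun h => .rel _ _ (h.imp_left (.mono hs))

mutual

theorem WfCtx.mono (hs : Φ ⊆ Φ') {Γ} : WfCtx Φ Γ → WfCtx Φ' Γ
  | .nil => .nil
  | .reg h => .reg (h.mono hs)
  | .conf h => .conf (h.mono hs)

theorem HasType.mono (hs : Φ ⊆ Φ') {Γ t A} : HasType Φ Γ t A → HasType Φ' Γ t A
  | .sort h => .sort (h.mono hs)
  | .var h hx => .var (h.mono hs) hx
  | .const h hc => .const (h.mono hs) (hc.mono hs)
  | .conv h hB hc => .conv (h.mono hs) (hB.mono hs) (hc.mono hs)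
  | .pi hA hB => .pi (hA.mono hs) (hB.mono hs)
  | .cpi hA hB => .cpi (hA.mono hs) (hB.mono hs)
  | .lam hA hB ht => .lam (hA.mono hs) (hB.mono hs) (ht.mono hs)
  | .clam hA hB ht => .clam (hA.mono hs) (hB.mono hs) (ht.mono hs)
  | .app ht hu => .app (ht.mono hs) (hu.mono hs)
  | .capp ht hl => .capp (ht.mono hs) (hl.mono hs)

theorem HasCType.mono (hs : Φ ⊆ Φ') {Γ l A} : HasCType Φ Γ l A → HasCType Φ' Γ l A
  | .var h hi => .var (h.mono hs) hi
  | .zero h => .zero (h.mono hs)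
  | .succ h => .succ (h.mono hs)
  | .max h h' => .max (h.mono hs) (h'.mono hs)
  | .conv h hB hc => .conv (h.mono hs) (hB.mono hs) (hc.mono hs)

end

theorem IsType.mono (hs : Φ ⊆ Φ') {Γ A} (h : IsType Φ Γ A) : IsType Φ' Γ A :=
  h.imp_right fun ⟨s, h⟩ => ⟨s, h.mono hs⟩

theorem ValidSig.cons (hΦ : ValidSig Φ) {e : Entry} (hf : Fresh e.name Φ)
    (ht : IsType Φ [] e.type) (hb : ∀ t ∈ e.body, HasType Φ [] t e.type) :
    ValidSig (e :: Φ) where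
  name_inj e₁ h₁ e₂ h₂ h := by
    obtain rfl | k₁ := List.mem_cons.1 h₁ <;> obtain rfl | k₂ := List.mem_cons.1 h₂
    · rfl
    · exact absurd h.symm (hf _ k₂)
    · exact absurd h (hf _ k₁)
    · exact hΦ.name_inj k₁ k₂ h
  type_valid h := by
    refine IsType.mono (List.subset_cons_self _ _) ?_
    obtain rfl | h := List.mem_cons.1 h
    exacts [ht, hΦ.type_valid h]
  body_typed h := by
    refine HasType.mono (List.subset_cons_self _ _) ?_
    obtain rfl | h := List.mem_cons.1 h
    exacts [hb _ rfl, hΦ.body_typed h]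

theorem WfSig.valid (h : WfSig Φ) : ValidSig Φ := by
  induction h with
  | nil => exact ⟨nofun, nofun, nofun⟩
  | decl _ hf h ih => exact ih.cons hf h.isType nofun
  | defn _ hf h ih => exact ih.cons hf (h.type_isType ih) fun t ht => by cases ht; exact h

end Signatures

/-! ### Soundness of the elaborator -/

theorem Unifies.union_iff {θ : LevelSubst} {C₁ C₂ : Problem} :
    Unifies θ (C₁ ∪ C₂) ↔ Unifies θ C₁ ∧ Unifies θ C₂ :=
  ⟨fun h => ⟨fun p hp => h p (.inl hp), fun p hp => h p (.inr hp)⟩,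
    fun h p hp => hp.elim (h.1 p) (h.2 p)⟩

section Constraints

variable {Φ : LocalSig} {θ : LevelSubst}

mutual

theorem ConvGen.sound (hΦ : RedSig Φ) {A B C} : ConvGen Φ A B C → Unifies θ C →
    Conv Φ (A.lsubst θ) (B.lsubst θ)
  | .mk hA hB h, hθ =>
    (Conv.steps (hA.1.lsubst hΦ θ)).trans
      ((h.sound hΦ hθ).trans (Conv.steps (hB.1.lsubst hΦ θ)).symm)

theorem ConvWhnf.sound (hΦ : RedSig Φ) {A B C} : ConvWhnf Φ A B C → Unifies θ C →
    Conv Φ (A.lsubst θ) (B.lsubst θ)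
  | .var _, _ | .const _, _ | .sort _, _ => .refl _
  | .lam h, hθ => by simpa only [Term.lsubst_lam] using (h.sound hΦ hθ).lam
  | .pi h h', hθ => by
    obtain ⟨hθ, hθ'⟩ := Unifies.union_iff.1 hθ
    simpa only [Term.lsubst_pi] using .pi (h.sound hΦ hθ) (h'.sound hΦ hθ')
  | .app h h', hθ =>
    have ⟨hθ, hθ'⟩ := Unifies.union_iff.1 hθ
    .app (h.sound hΦ hθ) (h'.sound hΦ hθ')
  | .capp h, hθ =>
    have ⟨hθ, hl⟩ := Unifies.union_iff.1 hθ
    .capp (h.sound hΦ hθ) (hl _ rfl)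

end

end Constraints

theorem lvlPis_succ (k : ℕ) (B : Term) : lvlPis (k + 1) B = lvlPis k (.cpi Lvl B) := by
  induction k with
  | zero => rfl
  | succ k ih => exact congrArg (Term.cpi Lvl) ih

theorem constApp_concat (c : Const) (is : List ℕ) (i : ℕ) :
    constApp c (is ++ [i]) = .capp (constApp c is) (.var i) :=
  List.foldl_append

theorem instLevels_nil : instLevels [] = .var := rfl

theorem instLevels_concat (is : List ℕ) (i : ℕ) :
    instLevels (is ++ [i]) = .cons (.var i) (instLevels is) := by
  funext n
  cases n with
  | zero => simp [instLevels, LevelSubst.cons]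
  | succ n => simp [instLevels, LevelSubst.cons]

/-- Every level in the image of `θ` has type `Lvl` in `Δ`. -/
def LevelSubstTyped (Φ : LocalSig) (θ : LevelSubst) (Δ : Ctx) : Prop :=
  ∀ i, HasCType Φ Δ (θ i) Lvl

/-- The context `Δ` contains the regular variables of `Γ`, with their types instantiated by `θ`,
and types the levels in the image of `θ`. -/
structure CtxInst (Φ : LocalSig) (θ : LevelSubst) (Γ Δ : Ctx) : Prop where
  levels : LevelSubstTyped Φ θ Δ
  lookup {x A} : Lookup Γ x A → Lookup Δ x (A.lsubst θ)

section Elaborator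

variable {Φ : LocalSig} {θ : LevelSubst}

theorem LevelSubstTyped.wfCtx {Δ} (h : LevelSubstTyped Φ θ Δ) : WfCtx Φ Δ := (h 0).wfCtx

theorem CtxInst.cons (hΦ : ValidSig Φ) {Γ Δ A} (h : CtxInst Φ θ Γ Δ)
    (hA : HasType Φ Δ (A.lsubst θ) (.sort .type)) :
    CtxInst Φ θ (.reg A :: Γ) (.reg (A.lsubst θ) :: Δ) where
  levels i := by
    simpa only [Level.rename_id, Term.rename] using (h.levels i).rename hΦ (.shift _ _) (.reg hA)
  lookup := by
    have shift_lsubst (B : Term) : B.shift.lsubst θ = (B.lsubst θ).shift := by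
      rw [Term.lsubst, Term.lsubst, ← Term.shift_subst, upSubst_var]
    rintro _ _ (_ | h' | _) <;> rw [shift_lsubst]
    · exact .here
    · exact .reg (h.lookup h')

theorem HasType.constApp_lsubst {Δ} (hθ : LevelSubstTyped Φ θ Δ) {c : Const} {is : List ℕ}
    {B : Term} (h : HasType Φ Δ (.const c) ((lvlPis is.length B).lsubst θ)) :
    HasType Φ Δ ((constApp c is).lsubst θ) ((B.lsubst (instLevels is)).lsubst θ) := by
  induction is using List.reverseRecOn generalizing B with
  | nil =>
    rw [instLevels_nil, Term.lsubst_lsubst]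
    exact h
  | append_singleton is i ih =>
    rw [List.length_append, List.length_singleton, lvlPis_succ] at h
    have h := ih h
    rw [Term.lsubst_lsubst] at h
    rw [constApp_concat, instLevels_concat, Term.lsubst_lsubst]
    convert h.capp_subst (hθ i) using 2
    · rfl
    · exact congrArg (B.subst .var) (funext fun | 0 => rfl | _ + 1 => rfl)

mutual

theorem Check.sound (hΦ : ValidSig Φ) {Γ D t T C} : Check Φ Γ D t T C → ∀ {Δ s},
    CtxInst Φ θ Γ Δ → Unifies θ C → HasType Φ Δ (T.lsubst θ) (.sort s) →
    HasType Φ Δ (t.lsubst θ) (T.lsubst θ)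
  | .switch h hc, _, _, hΔ, hθ, hT =>
    have ⟨hθ, hθ'⟩ := Unifies.union_iff.1 hθ
    .conv (h.sound hΦ hΔ hθ) hT (hc.sound hΦ.redSig hθ')
  | .lam hr h, _, _, hΔ, hθ, hT => by
    have hr := hr.1.lsubst hΦ.redSig θ
    have hc := (Conv.steps hr).symm
    rw [Term.lsubst_pi] at hr hc
    obtain ⟨hA, _, hB⟩ := (hT.steps hΦ hr).pi_inv
    rw [Term.lsubst_lam]
    exact .conv (.lam hA hB (h.sound hΦ (hΔ.cons hΦ hA) hθ hB)) hT hc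

theorem Infer.sound (hΦ : ValidSig Φ) {Γ D t T C} : Infer Φ Γ D t T C → ∀ {Δ},
    CtxInst Φ θ Γ Δ → Unifies θ C → HasType Φ Δ (t.lsubst θ) (T.lsubst θ)
  | .var h, _, hΔ, _ => .var hΔ.levels.wfCtx (hΔ.lookup h)
  | .const h, _, hΔ, _ => by
    refine .constApp_lsubst hΔ.levels ?_
    rw [Term.lsubst, h.closed hΦ]
    exact .const hΔ.levels.wfCtx h
  | .sort, _, hΔ, _ => .sort hΔ.levels.wfCtx
  | .pi hA hB hr, _, hΔ, hθ => by
    obtain ⟨hθ, hθ'⟩ := Unifies.union_iff.1 hθ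
    have hA := hA.sound hΦ hΔ hθ (.sort hΔ.levels.wfCtx)
    have hB := hB.sound hΦ (hΔ.cons hΦ hA) hθ'
    rw [Term.lsubst_pi]
    exact .pi hA (hB.type_steps hΦ (hr.1.lsubst hΦ.redSig θ))
  | .app h hr hu, _, hΔ, hθ => by
    obtain ⟨hθ, hθ'⟩ := Unifies.union_iff.1 hθ
    have ht := (h.sound hΦ hΔ hθ).type_steps hΦ (hr.1.lsubst hΦ.redSig θ)
    rw [Term.lsubst_pi] at ht
    rw [Term.lsubst_inst]
    exact .app ht (hu.sound hΦ hΔ hθ' (ht.type_isType hΦ).pi_inv.1)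

end

end Elaborator

/-! ### Generalization -/

theorem Unifies.comp {θ : LevelSubst} {C : Problem} (h : Unifies θ C) (η : LevelSubst) :
    Unifies (fun i => (θ i).subst η) C := fun p hp => by
  rw [← Level.subst_subst, ← Level.subst_subst]
  exact (h p hp).subst η

theorem Term.lsubst_cpi_captureRen (η : LevelSubst) (i : ℕ) (B : Term) :
    (Term.cpi Lvl (B.rename id (captureRen i))).lsubst η =
      .cpi Lvl (B.lsubst fun n => η.up (captureRen i n)) :=
  congrArg (Term.cpi Lvl) (Term.rename_subst ..)

theorem Term.lsubst_clam_captureRen (η : LevelSubst) (i : ℕ) (t : Term) :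
    (Term.clam (t.rename id (captureRen i))).lsubst η =
      .clam (t.lsubst fun n => η.up (captureRen i n)) :=
  congrArg Term.clam (Term.rename_subst ..)

theorem LevelSubst.up_congr {X : Finset ℕ} {θ θ' : LevelSubst}
    (h : ∀ i ∈ (X.erase 0).image Nat.pred, θ i = θ' i) : ∀ i ∈ X, θ.up i = θ'.up i
  | 0, _ => rfl
  | i + 1, hi => by
    simp only [LevelSubst.up, h i (Finset.mem_image.2 ⟨i + 1, by simp [hi], rfl⟩)]

theorem Term.subst_congr_lfv {σ : ℕ → Term} {θ θ' : LevelSubst} {t : Term}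
    (h : ∀ i ∈ t.lfv, θ i = θ' i) : t.subst σ θ = t.subst σ θ' := by
  induction t generalizing σ θ θ' with
  | var | const | sort => rfl
  | lam t ih => rw [subst, subst, ih h]
  | clam t ih => rw [subst, subst, ih (LevelSubst.up_congr h)]
  | pi A B ihA ihB | app A B ihA ihB =>
    rw [lfv, Finset.forall_mem_union] at h
    rw [subst, subst, ihA h.1, ihB h.2]
  | cpi A B ihA ihB =>
    rw [lfv, Finset.forall_mem_union] at h
    rw [subst, subst, ihA h.1, ihB (LevelSubst.up_congr h.2)]
  | capp t l ih =>
    rw [lfv, Finset.forall_mem_union] at h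
    rw [subst, subst, ih h.1, Level.subst_congr_fv h.2]

/-- `t` has type `A` under every level substitution that maps the variables in `S` to levels of
type `Lvl`. -/
def HasGenericType (Φ : LocalSig) (S : Set ℕ) (t A : Term) : Prop :=
  ∀ ⦃Δ η⦄, WfCtx Φ Δ → (∀ i ∈ S, HasCType Φ Δ (η i) Lvl) → HasType Φ Δ (t.lsubst η) (A.lsubst η)

section Generalization

variable {Φ : LocalSig} {S : Set ℕ} {A t : Term} {s : DkSort}

theorem LevelSubstTyped.subst {η : LevelSubst} {Δ} (h : LevelSubstTyped Φ η Δ) (l : Level) :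
    HasCType Φ Δ (l.subst η) Lvl := by
  induction l with
  | var i => exact h i
  | zero => exact .zero h.wfCtx
  | succ l ih => exact .succ ih
  | max l l' ih ih' => exact .max ih ih'

theorem hasCType_up_captureRen (hΦ : ValidSig Φ) {Δ} {η : LevelSubst} {i : ℕ} (hΔ : WfCtx Φ Δ)
    (hη : ∀ n ∈ S, HasCType Φ Δ (η n) Lvl) :
    ∀ n ∈ insert i S, HasCType Φ (.conf Lvl :: Δ) (η.up (captureRen i n)) Lvl := by
  intro n hn
  by_cases h : n = i
  · rw [captureRen, if_pos h]
    exact .var (.conf (.lvl hΔ)) .here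
  · rw [captureRen, if_neg h]
    exact (hη n (hn.resolve_left h)).rename hΦ (.cshift _ _) (.conf (.lvl hΔ))

theorem Enumerates.setOf_mem_union_empty {is : List ℕ} {X : Finset ℕ} (h : Enumerates is X) :
    {i | i ∈ is} ∪ ∅ = (X : Set ℕ) := by
  ext i
  simp [h.2 i]

theorem setOf_mem_cons_union (i : ℕ) (is : List ℕ) (S : Set ℕ) :
    {j | j ∈ i :: is} ∪ S = {j | j ∈ is} ∪ insert i S := by
  ext j
  simp only [List.mem_cons, Set.mem_union, Set.mem_ofPred_eq, Set.mem_insert_iff]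
  tauto

namespace HasGenericType

theorem hasType (h : HasGenericType Φ ∅ t A) : HasType Φ [] t A := by
  simpa only [Term.lsubst, Term.subst_var] using h (η := .var) .nil (by simp)

theorem cpi (hΦ : ValidSig Φ) {i : ℕ} (h : HasGenericType Φ (insert i S) A (.sort s)) :
    HasGenericType Φ S (.cpi Lvl (A.rename id (captureRen i))) (.sort s) := fun Δ η hΔ hη => by
  rw [Term.lsubst_cpi_captureRen]
  exact .cpi (.lvl hΔ) (h (.conf (.lvl hΔ)) (hasCType_up_captureRen hΦ hΔ hη))

theorem clam (hΦ : ValidSig Φ) {i : ℕ} (hA : HasGenericType Φ (insert i S) A (.sort s))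
    (ht : HasGenericType Φ (insert i S) t A) :
    HasGenericType Φ S (.clam (t.rename id (captureRen i)))
      (.cpi Lvl (A.rename id (captureRen i))) := fun Δ η hΔ hη => by
  rw [Term.lsubst_clam_captureRen, Term.lsubst_cpi_captureRen]
  have hη := hasCType_up_captureRen hΦ hΔ hη (i := i)
  have hΔ' := WfCtx.conf (.lvl hΔ)
  exact .clam (.lvl hΔ) (hA hΔ' hη) (ht hΔ' hη)

theorem generalize_pi (hΦ : ValidSig Φ) {is : List ℕ}
    (h : HasGenericType Φ ({i | i ∈ is} ∪ S) A (.sort s)) :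
    HasGenericType Φ S (genPi is A) (.sort s) := by
  induction is generalizing S with
  | nil => simpa [genPi] using h
  | cons i is ih =>
    rw [setOf_mem_cons_union] at h
    exact (ih h).cpi hΦ

theorem generalize_lam (hΦ : ValidSig Φ) {is : List ℕ}
    (hA : HasGenericType Φ ({i | i ∈ is} ∪ S) A (.sort s))
    (ht : HasGenericType Φ ({i | i ∈ is} ∪ S) t A) :
    HasGenericType Φ S (genLam is t) (genPi is A) := by
  induction is generalizing S with
  | nil => simpa [genPi, genLam] using ht
  | cons i is ih =>
    rw [setOf_mem_cons_union] at hA ht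
    exact .clam hΦ (hA.generalize_pi hΦ) (ih hA ht)

theorem restrict (h : HasGenericType Φ Set.univ t A) {X : Finset ℕ} (hX : A.lfv ⊆ X) :
    HasGenericType Φ X (t.lsubst (zeroOn (t.lfv \ X))) A := fun Δ η hΔ hη => by
  let η₀ : LevelSubst := fun i => if i ∈ X then η i else .zero
  have hη₀ : ∀ i, HasCType Φ Δ (η₀ i) Lvl := fun i => by
    by_cases hi : i ∈ X
    · simpa [η₀, hi] using hη i hi
    · simpa [η₀, hi] using .zero hΔ
  have hA : A.lsubst η = A.lsubst η₀ := Term.subst_congr_lfv fun i hi => by simp [η₀, hX hi]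
  have ht : (t.lsubst (zeroOn (t.lfv \ X))).lsubst η = t.lsubst η₀ := by
    rw [Term.lsubst_lsubst]
    refine Term.subst_congr_lfv fun i hi => ?_
    by_cases hX : i ∈ X <;> simp [zeroOn, η₀, hi, hX, Level.subst]
  rw [hA, ht]
  exact h hΔ fun i _ => hη₀ i

theorem restrict_lfv (h : HasGenericType Φ Set.univ A (.sort s)) :
    HasGenericType Φ A.lfv A (.sort s) := by
  have hzero : zeroOn (A.lfv \ A.lfv) = .var := by
    funext i
    simp [zeroOn]
  simpa only [hzero, Term.lsubst, Term.subst_var] using h.restrict (X := A.lfv) (by simp [Term.lfv])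

theorem hasType_genPi (hΦ : ValidSig Φ) {is : List ℕ} (his : Enumerates is A.lfv)
    (hA : HasGenericType Φ Set.univ A (.sort s)) : HasType Φ [] (genPi is A) (.sort s) :=
  (generalize_pi hΦ (his.setOf_mem_union_empty ▸ hA.restrict_lfv)).hasType

theorem hasType_genLam (hΦ : ValidSig Φ) {is : List ℕ} (his : Enumerates is A.lfv)
    (hA : HasGenericType Φ Set.univ A (.sort s)) (ht : HasGenericType Φ Set.univ t A) :
    HasType Φ [] (genLam is (t.lsubst (zeroOn (t.lfv \ A.lfv)))) (genPi is A) :=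
  (generalize_lam hΦ (his.setOf_mem_union_empty ▸ hA.restrict_lfv)
    (his.setOf_mem_union_empty ▸ ht.restrict subset_rfl)).hasType

end HasGenericType

theorem Check.hasGenericType (hΦ : ValidSig Φ) {θ : LevelSubst} {D T C}
    (h : Check Φ [] D t T C) (hθ : Unifies θ C)
    (hT : HasGenericType Φ Set.univ (T.lsubst θ) (.sort s)) :
    HasGenericType Φ Set.univ (t.lsubst θ) (T.lsubst θ) := fun Δ η hΔ hη => by
  have hlevels : LevelSubstTyped Φ (fun i => (θ i).subst η) Δ :=
    fun i => LevelSubstTyped.subst (fun j => hη j trivial) (θ i)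
  have hT := hT hΔ hη
  rw [Term.lsubst_lsubst] at hT
  rw [Term.lsubst_lsubst, Term.lsubst_lsubst]
  exact h.sound hΦ ⟨hlevels, nofun⟩ (hθ.comp η) hT

end Generalization

end UPP

theorem mainTheorem4 (Φ : UPP.LocalSig) (hΦ : UPP.WfSig Φ) (c : ℕ) (hc : UPP.Fresh c Φ)
    (A t : UPP.Term) (hA : UPP.Schematic A) (ht : UPP.Schematic t) :
    (∀ (C₁ C₂ : UPP.Problem) (θ : UPP.LevelSubst) (is : List ℕ),
      UPP.Check Φ [] ∅ A (.sort .type) C₁ →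
      UPP.Check Φ [] C₁ t A C₂ →
      UPP.Unifies θ (C₁ ∪ C₂) →
      UPP.Enumerates is (A.lsubst θ).lfv →
      UPP.WfSig
        (⟨c, UPP.genPi is (A.lsubst θ),
          some (UPP.genLam is
            ((t.lsubst θ).lsubst (UPP.zeroOn ((t.lsubst θ).lfv \ (A.lsubst θ).lfv))))⟩ :: Φ)) ∧
    (∀ (C₁ : UPP.Problem) (θ : UPP.LevelSubst) (is : List ℕ),
      UPP.Check Φ [] ∅ A (.sort .type) C₁ →
      UPP.Unifies θ C₁ →
      UPP.Enumerates is (A.lsubst θ).lfv →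
      UPP.WfSig (⟨c, UPP.genPi is (A.lsubst θ), none⟩ :: Φ)) := by
  have hv := hΦ.valid
  have htype {C₁ : UPP.Problem} {θ : UPP.LevelSubst} (hA : UPP.Check Φ [] ∅ A (.sort .type) C₁)
      (hθ : UPP.Unifies θ C₁) : UPP.HasGenericType Φ Set.univ (A.lsubst θ) (.sort .type) :=
    hA.hasGenericType hv hθ fun _ _ hΔ _ => .sort hΔ
  constructor
  · intro C₁ C₂ θ is hA ht hθ his
    obtain ⟨hθ₁, hθ₂⟩ := UPP.Unifies.union_iff.1 hθ
    have hA := htype hA hθ₁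
    have ht := ht.hasGenericType hv hθ₂ hA
    exact .defn hΦ hc (hA.hasType_genLam hv his ht)
  · intro C₁ θ is hA hθ his
    exact .decl hΦ hc ((htype hA hθ).hasType_genPi hv his)
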